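/- Let $S\in\mathbb N$ and fix an $S$-regular boundary-corrected (Cohen–Daubechies–Vial) Daubechies wavelet basis of $L^2[0,1]$, with coarsest level $J_0$, scaling functions $\phi_k$ $(1\le k\le 2^{J_0})$ and wavelets $\psi_{lk}$ $(l\ge J_0,\ 1\le k\le 2^l)$. For $s>0$ and continuous $f:[0,1]\to\mathbb R$ put $$\|f\|_{s,\infty}=\max\Bigl(\sup_k\Bigl|\int_0^1 f\phi_k\Bigr|,\ \sup_{l\ge J_0,k}2^{l(s+1/2)}\Bigl|\int_0^1 f\psi_{lk}\Bigr|\Bigr).$$ For $B\ge 1$ let $\Sigma(s)$ be the set of continuous $f:[0,1]\to[0,\infty)$ with $\int_0^1 f=1$ and $\|f\|_{s,\infty}\le B$. Let $r_n(s)=(\log n/n)^{s/(2s+1)}$. For $0<r<R$ and $\zeta>0$, a grid $\mathcal S_n(\zeta)$ is a finite set $\{r=s_1<s_2<\dots<s_{|\mathcal S_n|}=R\}$ with $\zeta/\log n\le s_{i+1}-s_i\le 2\zeta/\log n$ for all $i$ (so $|\mathcal S_n|\simeq\log n$); it is required for all large $n$. For nonnegative real numbers $\rho_n(s)$ put $$\tilde\Sigma(s,\rho_n(s),\mathcal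 S_n)=\Bigl\{f\in\Sigma(s):\ \inf_{g\in\Sigma(t)}\|g-f\|_\infty\ge\rho_n(s)\ \text{ for all } t\in\mathcal S_n,\ t>s\Bigr\}.$$ Let $X_1,\dots,X_n$ be i.i.d. on $[0,1]$ with density $f$; write $\Pr_f$ and $E_f$ for probability and expectation. A confidence band $C_n$ is a family of random intervals $C_n(y)=[c_n(y),c_n'(y)]$, $y\in[0,1]$, depending on $X_1,\dots,X_n$ (such that the coverage events and the diameter below are measurable), and $|C_n|=\sup_y|c_n'(y)-c_n(y)|$. **Theorem.** Let $0<R<S$, $B\ge1$, $L\ge1$ and $0<\alpha<1/3$. There is a finite $\zeta_0>0$, depending only on $R,B,L,\alpha$ and the fixed wavelet basis, such that the following holds for every $\zeta\ge\zeta_0$, every $r\in(0,R)$ and all grids $\mathcal S_n=\mathcal S_n(\zeta)$ of $[r,R]$. Let $s=s_n<s'=s'_n$ be any two points of $\mathcal S_n$ (possibly depending on $n$), let $\rho_n(\cdot)\ge0$, and suppose that $C_n$ is a sequence of confidence bands that is asymptotically honest with level $\alpha$ over $\mathcal P_n=\Sigma(s')\cup\tilde\Sigma(s,\rho_n(s),\mathcal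 S_n)$, that is, $$\liminf_n\inf_{f\in\mathcal P_n}\Pr\nolimits_f\bigl(f(y)\in C_n(y)\ \forall y\in[0,1]\bigr)\ge1-\alpha,$$ and adaptive, that is, for every $n$ large enough, $$\sup_{f\in\Sigma(s')}E_f|C_n|\le L\,r_n(s'),\qquad \sup_{f\in\tilde\Sigma(s,\rho_n(s),\mathcal S_n)}E_f|C_n|\le L\,r_n(s).$$ Then $$\liminf_n\frac{\rho_n(s)}{r_n(s)}>0.$$ -/

import Mathlib

open MeasureTheory Filter Topology Set
open scoped ENNReal BigOperators

noncomputable section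

/-! ## Daubechies wavelets on the line -/

/-- The mother wavelet `ψ = √2 ∑ₖ (-1)ᵏ h(1-k) φ(2·-k)` of a scaling function `φ` with filter `h`
supported in `{1-N, …, N}`. -/
def motherWavelet (N : ℕ) (h : ℤ → ℝ) (φ : ℝ → ℝ) (x : ℝ) : ℝ :=
  √2 * ∑ k ∈ Finset.Icc (1 - (N : ℤ)) N, (-1 : ℝ) ^ k * h (1 - k) * φ (2 * x - k)

/-- `φ` is a (continuous) Daubechies scaling function of order `N`, with filter `h`: it is supported
in `[1-N, N]`, has integral one and orthonormal integer translates, it satisfies the refinement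
equation for a filter with `2N` taps, and the associated wavelet has `N` vanishing moments. -/
structure IsDaubechiesScaling (N : ℕ) (h : ℤ → ℝ) (φ : ℝ → ℝ) : Prop where
  order_pos : 1 ≤ N
  continuous : Continuous φ
  support_subset : Function.support φ ⊆ Icc (1 - (N : ℝ)) N
  integral_eq_one : ∫ x, φ x = 1
  orthonormal : ∀ k : ℤ, ∫ x, φ x * φ (x - k) = if k = 0 then 1 else 0
  refinement : ∀ x, φ x = √2 * ∑ k ∈ Finset.Icc (1 - (N : ℤ)) N, h k * φ (2 * x - k)
  vanishing_moments : ∀ p < N, ∫ x, x ^ p * motherWavelet N h φ x = 0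

/-! ## Boundary corrected wavelets on the unit interval -/

/-- The `k`-th of the `2^j` functions at resolution level `j` on `[0,1]` generated by an interior
function `f` and `N` edge functions at each end point:
`2^{j/2} f(2^j x - k)` for `N ≤ k < 2^j - N`, `2^{j/2} fL k (2^j x)` for `k < N` and
`2^{j/2} fR (2^j - 1 - k) (2^j (x - 1))` for the last `N` indices.
(`fL i`, `i < N`, is a function on `[0,∞)` and `fR i`, `i < N`, a function on `(-∞,0]`.) -/
def levelFun (N : ℕ) (f : ℝ → ℝ) (fL fR : ℕ → ℝ → ℝ) (j : ℕ) (k : Fin (2 ^ j))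
    (x : unitInterval) : ℝ :=
  (2 : ℝ) ^ ((j : ℝ) / 2) *
    if (k : ℕ) < N then fL k (2 ^ j * (x : ℝ))
    else if (k : ℕ) + N < 2 ^ j then f (2 ^ j * (x : ℝ) - (k : ℕ))
    else fR (2 ^ j - 1 - (k : ℕ)) (2 ^ j * ((x : ℝ) - 1))

/-- An `S`-regular Daubechies wavelet basis of `[0,1]` with boundary correction
(Cohen, Daubechies and Vial). The left edge scaling functions are an orthonormalisation of the
restrictions to `[0,∞)` of the functions `∑ₘ q(m) φ(·-m)`, `q` a polynomial of degree less than `N`,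
the sum being over the translates which are not interior; similarly at the right end point. The
wavelets at level `l` lie in the scaling space of level `l+1`, those which are not at an edge are the
dilated translates of the mother wavelet, and scaling functions of level `J₀` and wavelets of all
levels `l ≥ J₀` form together an orthonormal system in `L²[0,1]`. -/
structure IntervalWaveletBasis (S : ℕ) where
  /-- order of the Daubechies scaling function -/
  N : ℕ
  /-- refinement filter -/
  h : ℤ → ℝ
  /-- scaling function on the line -/
  φ : ℝ → ℝ
  isDaubechies : IsDaubechiesScaling N h φ
  regular : ContDiff ℝ S φ
  /-- coarsest resolution level -/
  J₀ : ℕ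
  two_mul_order_le : 2 * N ≤ 2 ^ J₀
  /-- left edge scaling functions -/
  φL : ℕ → ℝ → ℝ
  /-- right edge scaling functions -/
  φR : ℕ → ℝ → ℝ
  /-- left edge wavelets -/
  ψL : ℕ → ℝ → ℝ
  /-- right edge wavelets -/
  ψR : ℕ → ℝ → ℝ
  left_scaling : ∀ i < N, ∃ q ∈ Polynomial.degreeLT ℝ N, ∀ x, 0 ≤ x →
    φL i x = ∑ m ∈ Finset.Icc (1 - (N : ℤ)) (N - 1), q.eval (m : ℝ) * φ (x - m)
  right_scaling : ∀ i < N, ∃ q ∈ Polynomial.degreeLT ℝ N, ∀ x, x ≤ 0 →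
    φR i x = ∑ m ∈ Finset.Icc (-(N : ℤ)) (N - 2), q.eval (m : ℝ) * φ (x - m)
  wavelet_mem_span : ∀ l, J₀ ≤ l → ∀ k : Fin (2 ^ l),
    levelFun N (motherWavelet N h φ) ψL ψR l k ∈
      Submodule.span ℝ (Set.range (levelFun N φ φL φR (l + 1)))
  scaling_orthonormal : ∀ k k' : Fin (2 ^ J₀),
    ∫ x, levelFun N φ φL φR J₀ k x * levelFun N φ φL φR J₀ k' x = if k = k' then 1 else 0
  scaling_wavelet_orthogonal : ∀ k : Fin (2 ^ J₀), ∀ l, J₀ ≤ l → ∀ k' : Fin (2 ^ l),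
    ∫ x, levelFun N φ φL φR J₀ k x * levelFun N (motherWavelet N h φ) ψL ψR l k' x = 0
  wavelet_orthonormal : ∀ l, J₀ ≤ l → ∀ k k' : Fin (2 ^ l),
    ∫ x, levelFun N (motherWavelet N h φ) ψL ψR l k x *
      levelFun N (motherWavelet N h φ) ψL ψR l k' x = if k = k' then 1 else 0
  wavelet_orthogonal : ∀ l l', J₀ ≤ l → J₀ ≤ l' → l ≠ l' →
    ∀ (k : Fin (2 ^ l)) (k' : Fin (2 ^ l')),
    ∫ x, levelFun N (motherWavelet N h φ) ψL ψR l k x *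
      levelFun N (motherWavelet N h φ) ψL ψR l' k' x = 0

namespace IntervalWaveletBasis

variable {S : ℕ} (W : IntervalWaveletBasis S)

/-- The scaling functions `φ_k` (at the coarsest level `J₀`) of the basis. -/
def scaling (k : Fin (2 ^ W.J₀)) (x : unitInterval) : ℝ :=
  levelFun W.N W.φ W.φL W.φR W.J₀ k x

/-- The wavelets `ψ_{lk}` of the basis, to be used for `l ≥ J₀`. -/
def wavelet (l : ℕ) (k : Fin (2 ^ l)) (x : unitInterval) : ℝ :=
  levelFun W.N (motherWavelet W.N W.h W.φ) W.ψL W.ψR l k x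

/-- The scaling coefficients `α_k(f) = ∫ f φ_k`. -/
def scalingCoeff (f : C(unitInterval, ℝ)) (k : Fin (2 ^ W.J₀)) : ℝ :=
  ∫ x, f x * W.scaling k x

/-- The wavelet coefficients `β_{lk}(f) = ∫ f ψ_{lk}`. -/
def waveletCoeff (f : C(unitInterval, ℝ)) (l : ℕ) (k : Fin (2 ^ l)) : ℝ :=
  ∫ x, f x * W.wavelet l k x

/-- The Hölder norm `‖f‖_{s,∞} = max (sup_k |α_k(f)|) (sup_{l ≥ J₀, k} 2^{l(s+1/2)} |β_{lk}(f)|)`,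
with values in `[0,∞]`. -/
def holderNorm (s : ℝ) (f : C(unitInterval, ℝ)) : ℝ≥0∞ :=
  max (⨆ k, ENNReal.ofReal |W.scalingCoeff f k|)
    (⨆ (l : ℕ) (_ : W.J₀ ≤ l) (k : Fin (2 ^ l)),
      ENNReal.ofReal ((2 : ℝ) ^ ((l : ℝ) * (s + 1 / 2)) * |W.waveletCoeff f l k|))

/-- The class `Σ(s) = Σ(s, B)` of probability densities on `[0,1]` in the Hölder ball. -/
def densityBall (B s : ℝ) : Set C(unitInterval, ℝ) :=
  {f | (∀ x, 0 ≤ f x) ∧ ∫ x, f x = 1 ∧ W.holderNorm s f ≤ ENNReal.ofReal B}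

/-- The class of those `f ∈ Σ(s)` with `inf_{g ∈ Σ(t)} ‖g - f‖_∞ ≥ ρ` for all `t > s`, `t ∈ G`. -/
def separatedBall (B s ρ : ℝ) (G : Finset ℝ) : Set C(unitInterval, ℝ) :=
  {f ∈ W.densityBall B s | ∀ t ∈ G, s < t → ∀ g ∈ W.densityBall B t, ρ ≤ ‖g - f‖}

end IntervalWaveletBasis

/-! ## Sampling model and confidence bands -/

/-- The joint law of `n` independent observations with density `f` on `[0,1]`. -/
def sampleLaw (n : ℕ) (f : C(unitInterval, ℝ)) : Measure (Fin n → unitInterval) :=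
  Measure.pi fun _ => (volume : Measure unitInterval).withDensity fun x => ENNReal.ofReal (f x)

/-- A confidence band based on a sample of size `n`: random intervals `[lower x y, upper x y]`,
`y ∈ [0,1]`, where `x` is the sample. Only the measurability that is needed for coverage
probabilities and expected diameters is required, up to Lebesgue null sets. -/
structure ConfidenceBand (n : ℕ) where
  /-- lower end points -/
  lower : (Fin n → unitInterval) → unitInterval → ℝ
  /-- upper end points -/
  upper : (Fin n → unitInterval) → unitInterval → ℝ
  nullMeasurableSet_cover : ∀ f : C(unitInterval, ℝ),
    NullMeasurableSet {x | ∀ y, f y ∈ Icc (lower x y) (upper x y)} volume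
  aemeasurable_diam : AEMeasurable (fun x => ⨆ y, ENNReal.ofReal |upper x y - lower x y|) volume

namespace ConfidenceBand

variable {n : ℕ} (C : ConfidenceBand n)

/-- The event that the band contains the graph of `f`. -/
def cover (f : C(unitInterval, ℝ)) : Set (Fin n → unitInterval) :=
  {x | ∀ y, f y ∈ Icc (C.lower x y) (C.upper x y)}

/-- The maximal diameter of the band. -/
def diam (x : Fin n → unitInterval) : ℝ≥0∞ :=
  ⨆ y, ENNReal.ofReal |C.upper x y - C.lower x y|

/-- The expected maximal diameter under the density `f`. -/
def expectedDiam (f : C(unitInterval, ℝ)) : ℝ≥0∞ :=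
  ∫⁻ x, C.diam x ∂(sampleLaw n f)

end ConfidenceBand

/-- Asymptotic honesty with level `α` of a sequence of bands over a sequence `P n` of classes. -/
def AsymptoticallyHonest (C : ∀ n, ConfidenceBand n) (α : ℝ) (P : ℕ → Set C(unitInterval, ℝ)) :
    Prop :=
  ENNReal.ofReal (1 - α) ≤ liminf (fun n => ⨅ f ∈ P n, sampleLaw n f ((C n).cover f)) atTop

/-- The rate `r_n(s) = (log n / n)^{s/(2s+1)}`. -/
def rate (n : ℕ) (s : ℝ) : ℝ := (Real.log n / n) ^ (s / (2 * s + 1))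

/-- `G` is a grid in `[r,R]` which contains `r` and `R` and in which the distance between
neighbouring points is at least `ζ / log n` and at most `2 ζ / log n`. -/
structure IsGrid (r R ζ : ℝ) (n : ℕ) (G : Finset ℝ) : Prop where
  subset_Icc : (G : Set ℝ) ⊆ Icc r R
  left_mem : r ∈ G
  right_mem : R ∈ G
  spacing : ∀ s ∈ G, ∀ t ∈ G, s < t → (∀ u ∈ G, ¬(s < u ∧ u < t)) →
    ζ / Real.log n ≤ t - s ∧ t - s ≤ 2 * ζ / Real.log n

end

open MeasureTheory Filter Topology Set
open scoped ENNReal BigOperators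

noncomputable section

/-! ## Partition of unity -/

namespace IsDaubechiesScaling

variable {N : ℕ} {h : ℤ → ℝ} {φ : ℝ → ℝ} (H : IsDaubechiesScaling N h φ)
include H

/-! The proof is a testing argument. Suppose `ρ ≤ c * rate n s` for infinitely many `n`. Test the
uniform density, a member of every `Σ(t)`, against the bumps `1 + b ψ_{lk}`, with `2^{l(2s+1)}` of
order `n / log n`, `b = ε 2^{-l(s+1/2)}` and `k` interior.

A density in `Σ(t)`, `t > s` in the grid, has `l`-th coefficients smaller than `b` by a factor `B
e^{-const·ζ} / ε`, because grid points differ by at least `ζ / log n` and `l` is of order `log n`.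
For large `ζ` this is at most `1/2`, so each bump is at sup-distance at least `c * rate n s` from
`Σ(t)`, and the band must cover it. For the same reason `rate n s'` is a small multiple of `rate n
s`, so under the uniform density the band is usually too narrow to contain a bump as well. Hence it
yields a test (`ConfidenceBand.one_le_of_separated`). But about `2^l` orthogonal bumps, a power of
`n`, with `n b² ≤ ε² log n` cannot be detected: the chi-square distance of their mixture from
uniform tends to zero (`volume_real_le_of_sampleLaw_real_le`). `one_le_of_band` combines these
bounds.

Bumps have mass one only if wavelets integrate to zero (`integral_wavelet`). This follows once
constants lie in the coarsest scaling space, which rests on the partition of unity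
`tsum_translates`. -/

theorem eq_zero_of_le {x : ℝ} (hx : x ≤ 1 - N) : φ x = 0 := by
  have hcl : IsClosed {x | φ x = 0} := isClosed_eq H.continuous continuous_const
  have hsub : Iio (1 - (N : ℝ)) ⊆ {x | φ x = 0} := fun y hy => by
    by_contra hne
    exact absurd (H.support_subset hne).1 (not_le.2 hy)
  have := hcl.closure_subset_iff.2 hsub
  rw [closure_Iio] at this
  exact this hx

theorem eq_zero_of_ge {x : ℝ} (hx : (N : ℝ) ≤ x) : φ x = 0 := by
  have hcl : IsClosed {x | φ x = 0} := isClosed_eq H.continuous continuous_const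
  have hsub : Ioi (N : ℝ) ⊆ {x | φ x = 0} := fun y hy => by
    by_contra hne
    exact absurd (H.support_subset hne).2 (not_le.2 hy)
  have := hcl.closure_subset_iff.2 hsub
  rw [closure_Ioi] at this
  exact this hx

theorem hasCompactSupport : HasCompactSupport φ :=
  HasCompactSupport.of_support_subset_isCompact isCompact_Icc H.support_subset

theorem integrable : Integrable φ := H.continuous.integrable_of_hasCompactSupport H.hasCompactSupport

theorem integral_comp_two_mul_sub (k : ℤ) : ∫ x, φ (2 * x - k) = 1 / 2 := by
  have := Measure.integral_comp_mul_left (fun y => φ (y - k)) 2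
  rw [this, integral_sub_right_eq_self, H.integral_eq_one]
  norm_num

theorem integrable_comp_two_mul_sub (k : ℤ) : Integrable fun x => φ (2 * x - k) :=
  (H.integrable.comp_sub_right (k : ℝ)).comp_mul_left' two_ne_zero

/-- Integrate the refinement equation; each dilated translate contributes `1/2`. -/
theorem sum_filter : ∑ k ∈ Finset.Icc (1 - (N : ℤ)) N, h k = √2 := by
  have h1 : ∫ x, √2 * ∑ k ∈ Finset.Icc (1 - (N : ℤ)) N, h k * φ (2 * x - k) = 1 := by
    rw [← H.integral_eq_one]
    exact integral_congr_ae (.of_forall fun x => (H.refinement x).symm)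
  rw [integral_const_mul, integral_finsetSum _
    fun k _ => (H.integrable_comp_two_mul_sub k).const_mul _] at h1
  simp_rw [integral_const_mul, H.integral_comp_two_mul_sub] at h1
  rw [← Finset.sum_mul] at h1
  have h2 : √2 * √2 = (2 : ℝ) := Real.mul_self_sqrt zero_le_two
  have h3 : √2 ≠ 0 := by positivity
  apply mul_left_cancel₀ h3
  rw [h2]
  linarith

/-- This is the zeroth vanishing moment of the mother wavelet; the reflection `k ↦ 1 - k` flips the
parity. -/
theorem sum_alternating_filter : ∑ k ∈ Finset.Icc (1 - (N : ℤ)) N, (-1 : ℝ) ^ k * h k = 0 := by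
  have h1 := H.vanishing_moments 0 H.order_pos
  simp only [pow_zero, one_mul, motherWavelet] at h1
  rw [integral_const_mul, integral_finsetSum _
    fun k _ => (H.integrable_comp_two_mul_sub k).const_mul _] at h1
  simp_rw [integral_const_mul, H.integral_comp_two_mul_sub] at h1
  rw [← Finset.sum_mul] at h1
  have h2 : ∑ k ∈ Finset.Icc (1 - (N : ℤ)) N, (-1 : ℝ) ^ k * h (1 - k) = 0 := by
    have h3 : √2 ≠ 0 := by positivity
    have := (mul_eq_zero.1 h1).resolve_left h3
    linarith
  have h4 : ∑ k ∈ Finset.Icc (1 - (N : ℤ)) N, (-1 : ℝ) ^ k * h k =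
      ∑ k ∈ Finset.Icc (1 - (N : ℤ)) N, -((-1 : ℝ) ^ k * h (1 - k)) := by
    refine Finset.sum_nbij' (fun k => 1 - k) (fun k => 1 - k) ?_ ?_ ?_ ?_ ?_
    · intro k hk; simp only [Finset.mem_Icc] at hk ⊢; lia
    · intro k hk; simp only [Finset.mem_Icc] at hk ⊢; lia
    · intro k _; ring
    · intro k _; ring
    · intro k _
      rw [sub_sub_cancel, zpow_sub₀ (by norm_num), zpow_one]
      have : ((-1 : ℝ) ^ k) * (-1) ^ k = 1 := by
        rw [← mul_zpow]; simp
      have h0 : ((-1 : ℝ) ^ k) ≠ 0 := zpow_ne_zero _ (by norm_num)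
      field_simp
      linear_combination h k * this
  rw [h4, Finset.sum_neg_distrib, h2, neg_zero]

/-- The two sum rules together say that the even and the odd taps each sum to `1/√2`. -/
theorem sum_filter_mul_ite (a b : ℝ) :
    √2 * ∑ k ∈ Finset.Icc (1 - (N : ℤ)) N, h k * (if Even k then a else b) = a + b := by
  have h1 : ∀ k : ℤ, h k * (if Even k then a else b) =
      h k * ((a + b) / 2) + (-1 : ℝ) ^ k * h k * ((a - b) / 2) := fun k => by
    split_ifs with hk
    · rw [hk.neg_one_zpow]; ring
    · rw [(Int.not_even_iff_odd.1 hk).neg_one_zpow]; ring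
  simp_rw [h1]
  rw [Finset.sum_add_distrib, ← Finset.sum_mul, ← Finset.sum_mul, H.sum_filter,
    H.sum_alternating_filter, zero_mul, add_zero, ← mul_assoc, Real.mul_self_sqrt zero_le_two]
  ring

theorem summable_translates (x : ℝ) : Summable fun m : ℤ => φ (x - m) := by
  refine summable_of_ne_finset_zero (s := Finset.Icc (⌊x⌋ - N) (⌈x⌉ + N)) fun m hm => ?_
  rw [Finset.mem_Icc, not_and_or, not_le, not_le] at hm
  rcases hm with hm | hm
  · apply H.eq_zero_of_ge
    have h1 : (m : ℝ) ≤ ((⌊x⌋ - N : ℤ) : ℝ) := by exact_mod_cast hm.le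
    push_cast at h1
    linarith [Int.floor_le x]
  · apply H.eq_zero_of_le
    have h1 : ((⌈x⌉ + N + 1 : ℤ) : ℝ) ≤ (m : ℝ) := by exact_mod_cast hm
    push_cast at h1
    linarith [Int.le_ceil x]

/-- Refining every translate regroups the sum by the parity of `2m + k`; the even and odd taps then
carry equal weight. -/
theorem tsum_translates_two_mul (x : ℝ) :
    ∑' m : ℤ, φ (x - m) = ∑' m : ℤ, φ (2 * x - m) := by
  set Q : ℤ → ℝ := fun k => ∑' m : ℤ, φ (2 * x - (2 * m + k : ℤ)) with hQ
  have hinj : ∀ k : ℤ, Function.Injective fun m : ℤ => 2 * m + k := fun k a b hab => by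
    simpa using hab
  have hs : ∀ k : ℤ, Summable fun m : ℤ => φ (2 * x - (2 * m + k : ℤ)) := fun k =>
    (H.summable_translates (2 * x)).comp_injective (hinj k)
  have hper : ∀ k j : ℤ, Q (k + 2 * j) = Q k := fun k j => by
    rw [hQ]
    refine Eq.trans ?_ ((Equiv.addRight j).tsum_eq fun m : ℤ => φ (2 * x - (2 * m + k : ℤ)))
    refine tsum_congr fun m => ?_
    simp only [Equiv.coe_addRight]
    congr 3
    ring
  have hQk : ∀ k : ℤ, Q k = if Even k then Q 0 else Q 1 := fun k => by
    split_ifs with hk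
    · obtain ⟨j, rfl⟩ := hk
      rw [← hper 0 j]; congr 1; ring
    · obtain ⟨j, rfl⟩ := Int.not_even_iff_odd.1 hk
      rw [← hper 1 j]; congr 1; ring
  have hsum : ∑' m : ℤ, φ (2 * x - m) = Q 0 + Q 1 := by
    have hrange : range (fun m : ℤ => 2 * m + 0) = {n | Even n} := by
      ext n; simp [even_iff_exists_two_mul]
    have hrange' : range (fun m : ℤ => 2 * m + 1) = {n | Odd n} := by
      ext n; simp [Odd]
    have he : HasSum ((fun m : ℤ => φ (2 * x - m)) ∘ fun m : ℤ => 2 * m + 0) (Q 0) := (hs 0).hasSum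
    have ho : HasSum ((fun m : ℤ => φ (2 * x - m)) ∘ fun m : ℤ => 2 * m + 1) (Q 1) := (hs 1).hasSum
    have hcompl : IsCompl (range fun m : ℤ => 2 * m + 0) (range fun m : ℤ => 2 * m + 1) := by
      rw [hrange, hrange']; exact Int.isCompl_even_odd
    exact (HasSum.add_isCompl (f := fun m : ℤ => φ (2 * x - m)) hcompl
      ((hinj 0).hasSum_range_iff.2 he) ((hinj 1).hasSum_range_iff.2 ho)).tsum_eq
  rw [hsum, ← H.sum_filter_mul_ite (Q 0) (Q 1)]
  simp_rw [← hQk]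
  have hsr : ∀ m : ℤ, φ (x - m) = √2 * ∑ k ∈ Finset.Icc (1 - (N : ℤ)) N,
      h k * φ (2 * x - (2 * m + k : ℤ)) := fun m => by
    rw [H.refinement]
    congr 1
    refine Finset.sum_congr rfl fun k _ => ?_
    congr 2
    push_cast
    ring
  simp_rw [hsr]
  rw [tsum_mul_left, Summable.tsum_finsetSum fun k _ => (hs k).mul_left _]
  simp_rw [tsum_mul_left]
  rfl

theorem tsum_translates_eq_sum {x : ℝ} {a b : ℤ} (ha : (a : ℝ) ≤ x) (hb : x ≤ b) :
    ∑' m : ℤ, φ (x - m) = ∑ m ∈ Finset.Icc (a + 1 - N) (b + N - 1), φ (x - m) := by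
  refine tsum_eq_sum fun m hm => ?_
  rw [Finset.mem_Icc, not_and_or, not_le, not_le] at hm
  rcases hm with hm | hm
  · apply H.eq_zero_of_ge
    have h1 : (m : ℝ) ≤ ((a - N : ℤ) : ℝ) := by exact_mod_cast (by lia : m ≤ a - N)
    push_cast at h1
    linarith
  · apply H.eq_zero_of_le
    have h1 : ((b + N - 1 : ℤ) : ℝ) + 1 ≤ (m : ℝ) := by exact_mod_cast hm
    push_cast at h1
    linarith

/-- Iterated halving moves `x` to `0` without changing the sum, which near `0` is a fixed finite sum
of continuous functions. -/
theorem tsum_translates_eq_zero_apply (x : ℝ) :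
    ∑' m : ℤ, φ (x - m) = ∑' m : ℤ, φ (0 - m) := by
  have h1 : ∀ n : ℕ, ∑' m : ℤ, φ (x * (1 / 2) ^ n - m) = ∑' m : ℤ, φ (x - m) := fun n => by
    induction n with
    | zero => simp
    | succ n ih =>
      rw [H.tsum_translates_two_mul, ← ih]
      refine tsum_congr fun m => ?_
      congr 2
      ring
  have h2 : Tendsto (fun n : ℕ => x * (1 / 2 : ℝ) ^ n) atTop (𝓝 0) := by
    simpa using (tendsto_pow_atTop_nhds_zero_of_lt_one (by norm_num : (0 : ℝ) ≤ 1 / 2)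
      (by norm_num)).const_mul x
  set F : ℝ → ℝ := fun y => ∑ m ∈ Finset.Icc ((-1 : ℤ) + 1 - N) (1 + N - 1), φ (y - m) with hF
  have hFc : Continuous F :=
    continuous_finsetSum _ fun m _ => H.continuous.comp (continuous_id.sub continuous_const)
  have hFe : ∀ y : ℝ, |y| ≤ 1 → ∑' m : ℤ, φ (y - m) = F y := fun y hy => by
    rw [abs_le] at hy
    exact H.tsum_translates_eq_sum (by push_cast; exact hy.1) (by push_cast; exact hy.2)
  have h3 : Tendsto (fun n : ℕ => F (x * (1 / 2 : ℝ) ^ n)) atTop (𝓝 (F 0)) :=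
    (hFc.tendsto 0).comp h2
  have h4 : ∀ᶠ n : ℕ in atTop, F (x * (1 / 2 : ℝ) ^ n) = ∑' m : ℤ, φ (x - m) := by
    have : ∀ᶠ y : ℝ in 𝓝 0, |y| ≤ 1 := by
      filter_upwards [Metric.ball_mem_nhds (0 : ℝ) one_pos] with y hy
      simpa using (mem_ball_zero_iff.1 hy).le
    filter_upwards [h2.eventually this] with n hn
    rw [← hFe _ hn, h1]
  rw [hFe 0 (by simp)]
  exact tendsto_nhds_unique (tendsto_const_nhds.congr' (h4.mono fun n hn => hn.symm)) h3

/-- The integer translates of a Daubechies scaling function form a partition of unity. -/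
theorem tsum_translates (x : ℝ) : ∑' m : ℤ, φ (x - m) = 1 := by
  rw [H.tsum_translates_eq_zero_apply]
  set c := ∑' m : ℤ, φ (0 - m)
  -- Cutting `∫ φ = 1` into unit intervals shows that the constant `c`, integrated over `[0,1]`,
  -- equals one.
  have hs := H.integrable.hasSum_intervalIntegral_comp_add_int
  rw [H.integral_eq_one, ← (Equiv.neg ℤ).hasSum_iff] at hs
  have h0 : ∀ m : ℤ, m ∉ Finset.Icc ((0 : ℤ) + 1 - N) (1 + N - 1) →
      ((fun n : ℤ => ∫ x in (0 : ℝ)..1, φ (x + n)) ∘ Equiv.neg ℤ) m = 0 := fun m hm => by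
    simp only [Function.comp_apply, Equiv.neg_apply]
    rw [intervalIntegral.integral_congr (g := fun _ => 0) fun y hy => ?_]
    · simp
    · rw [uIcc_of_le zero_le_one] at hy
      rw [Finset.mem_Icc, not_and_or, not_le, not_le] at hm
      rcases hm with hm | hm
      · apply H.eq_zero_of_ge
        have h1 : (m : ℝ) ≤ ((-N : ℤ) : ℝ) := by exact_mod_cast (by lia : m ≤ -N)
        push_cast at h1 ⊢
        linarith [hy.1]
      · apply H.eq_zero_of_le
        have h1 : ((1 + N - 1 : ℤ) : ℝ) + 1 ≤ (m : ℝ) := by exact_mod_cast hm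
        push_cast at h1 ⊢
        linarith [hy.2]
  have h1 := hs.unique (hasSum_sum_of_ne_finset_zero h0)
  simp only [Function.comp_apply, Equiv.neg_apply] at h1
  rw [h1, ← intervalIntegral.integral_finsetSum]
  · rw [intervalIntegral.integral_congr (g := fun _ => c)]
    · simp
    · intro y hy
      rw [uIcc_of_le zero_le_one] at hy
      have := H.tsum_translates_eq_sum (x := y) (a := 0) (b := 1) (by simpa using hy.1)
        (by simpa using hy.2)
      rw [H.tsum_translates_eq_zero_apply] at this
      refine Eq.trans ?_ this.symm
      exact Finset.sum_congr rfl fun m _ => by push_cast; rw [sub_eq_add_neg]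
  · intro m _
    exact (H.continuous.comp (continuous_id.add continuous_const)).intervalIntegrable _ _

/-! ### Continuity and compact support of the mother wavelet -/

theorem continuous_motherWavelet : Continuous (motherWavelet N h φ) := by
  have := H.continuous
  unfold motherWavelet
  fun_prop

theorem hasCompactSupport_motherWavelet : HasCompactSupport (motherWavelet N h φ) := by
  refine HasCompactSupport.of_support_subset_isCompact
    (isCompact_Icc (a := 1 - (N : ℝ)) (b := N)) fun x hx => ?_
  by_contra hx'
  refine hx ?_
  unfold motherWavelet
  rw [Finset.sum_eq_zero, mul_zero]
  intro k hk
  rw [Finset.mem_Icc] at hk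
  have hk1 : ((1 - N : ℤ) : ℝ) ≤ k := by exact_mod_cast hk.1
  have hk2 : (k : ℝ) ≤ ((N : ℤ) : ℝ) := by exact_mod_cast hk.2
  push_cast at hk1 hk2
  rw [mem_Icc, not_and_or, not_le, not_le] at hx'
  rcases hx' with hx' | hx'
  · rw [H.eq_zero_of_le (by linarith), mul_zero]
  · rw [H.eq_zero_of_ge (by linarith), mul_zero]

end IsDaubechiesScaling

/-! ## The testing lower bound -/

section Testing

variable {X : Type*} [TopologicalSpace X] [CompactSpace X] [MeasurableSpace X]
  [OpensMeasurableSpace X] {μ : Measure X}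

theorem Continuous.integrable_of_compactSpace [IsFiniteMeasure μ] {f : X → ℝ} (hf : Continuous f) :
    Integrable f μ := by
  have h := hf.continuousOn.integrableOn_compact' (μ := μ) isCompact_univ MeasurableSet.univ
  rwa [integrableOn_univ] at h

theorem sq_integral_le_integral_sq [IsProbabilityMeasure μ] {f : X → ℝ} (hf : Continuous f) :
    (∫ x, f x ∂μ) ^ 2 ≤ ∫ x, f x ^ 2 ∂μ := by
  set c := ∫ x, f x ∂μ with hc
  have h0 : 0 ≤ ∫ x, (f x - c) ^ 2 ∂μ := integral_nonneg fun x => sq_nonneg _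
  have h1 : ∫ x, (f x - c) ^ 2 ∂μ = (∫ x, f x ^ 2 ∂μ) - 2 * c * c + c ^ 2 := by
    have : ∀ x, (f x - c) ^ 2 = f x ^ 2 - 2 * c * f x + c ^ 2 := fun x => by ring
    simp_rw [this]
    rw [integral_add, integral_sub, integral_const_mul, integral_const]
    · simp [hc]
    · exact (hf.pow 2).integrable_of_compactSpace
    · exact (hf.const_mul _).integrable_of_compactSpace
    · exact ((hf.pow 2).sub (hf.const_mul _)).integrable_of_compactSpace
    · exact integrable_const _
  nlinarith

end Testing

/-! ### The joint law of the sample -/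

theorem continuous_prod_apply {n : ℕ} (f : C(unitInterval, ℝ)) :
    Continuous fun x : Fin n → unitInterval => ∏ i, f (x i) := by fun_prop

/-- Both measures agree on boxes, where the integral of the product density factorises. -/
theorem sampleLaw_eq_withDensity (n : ℕ) {f : C(unitInterval, ℝ)} (hf : ∀ x, 0 ≤ f x) :
    sampleLaw n f = (volume : Measure (Fin n → unitInterval)).withDensity
      fun x => ENNReal.ofReal (∏ i, f (x i)) := by
  have : IsFiniteMeasure
      ((volume : Measure unitInterval).withDensity fun x => ENNReal.ofReal (f x)) :=
    isFiniteMeasure_withDensity_ofReal f.continuous.integrable_of_compactSpace.2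
  refine Measure.pi_eq fun s hs => ?_
  rw [withDensity_apply _ (MeasurableSet.univ_pi hs),
    ← ofReal_integral_eq_lintegral_ofReal
      (continuous_prod_apply f).integrable_of_compactSpace
      (Eventually.of_forall fun x => Finset.prod_nonneg fun i _ => hf _),
    volume_pi, Measure.restrict_pi_pi,
    integral_fintype_prod_eq_prod (μ := fun i => (volume : Measure unitInterval).restrict (s i))
      (fun _ => f),
    ENNReal.ofReal_prod_of_nonneg fun i _ => integral_nonneg hf]
  refine Finset.prod_congr rfl fun i _ => ?_
  rw [withDensity_apply _ (hs i), ofReal_integral_eq_lintegral_ofReal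
    f.continuous.integrable_of_compactSpace (Eventually.of_forall hf)]

theorem sampleLaw_one (n : ℕ) : sampleLaw n 1 = volume := by
  rw [sampleLaw_eq_withDensity n (fun x => by simp)]
  simp

theorem sampleLaw_absolutelyContinuous (n : ℕ) {f : C(unitInterval, ℝ)} (hf : ∀ x, 0 ≤ f x) :
    sampleLaw n f ≪ volume := by
  rw [sampleLaw_eq_withDensity n hf]
  exact withDensity_absolutelyContinuous _ _

theorem isProbabilityMeasure_sampleLaw (n : ℕ) {f : C(unitInterval, ℝ)} (hf : ∀ x, 0 ≤ f x)
    (h1 : ∫ x, f x = 1) : IsProbabilityMeasure (sampleLaw n f) := by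
  have : IsProbabilityMeasure
      ((volume : Measure unitInterval).withDensity fun x => ENNReal.ofReal (f x)) := by
    refine ⟨?_⟩
    rw [withDensity_apply _ MeasurableSet.univ, Measure.restrict_univ,
      ← ofReal_integral_eq_lintegral_ofReal f.continuous.integrable_of_compactSpace (Eventually.of_forall hf), h1, ENNReal.ofReal_one]
  unfold sampleLaw
  infer_instance

theorem sampleLaw_real_eq_setIntegral (n : ℕ) {f : C(unitInterval, ℝ)} (hf : ∀ x, 0 ≤ f x)
    (A : Set (Fin n → unitInterval)) :
    (sampleLaw n f).real A = ∫ x in A, ∏ i, f (x i) := by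
  have hp : ∀ x : Fin n → unitInterval, 0 ≤ ∏ i, f (x i) :=
    fun x => Finset.prod_nonneg fun i _ => hf _
  rw [measureReal_def, sampleLaw_eq_withDensity n hf, withDensity_apply',
    ← ofReal_integral_eq_lintegral_ofReal
      (continuous_prod_apply f).integrable_of_compactSpace (Eventually.of_forall hp),
    ENNReal.toReal_ofReal (integral_nonneg hp)]

/-- Testing the uniform density against a finite family of densities `f k` whose centred versions
are orthogonal with squared norm `v`. -/
theorem volume_real_le_of_sampleLaw_real_le {ι : Type*} [Fintype ι] [Nonempty ι] [DecidableEq ι]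
    (n : ℕ) (f : ι → C(unitInterval, ℝ)) (hf : ∀ k x, 0 ≤ f k x) (h1 : ∀ k, ∫ x, f k x = 1)
    {v : ℝ} (h2 : ∀ k l, ∫ x, f k x * f l x = 1 + if k = l then v else 0)
    (A : Set (Fin n → unitInterval)) {b : ℝ} (hb : ∀ k, (sampleLaw n (f k)).real A ≤ b) :
    (volume : Measure (Fin n → unitInterval)).real A ≤
      b + √(((1 + v) ^ n - 1) / Fintype.card ι) := by
  set M : ℝ := ((Fintype.card ι : ℕ) : ℝ) with hM
  have hM0 : 0 < M := by simp [hM, Fintype.card_pos]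
  -- Likelihood ratio of the uniform mixture of the alternatives.
  set Z : (Fin n → unitInterval) → ℝ := fun x => M⁻¹ * ∑ k, ∏ i, f k (x i) with hZ
  have hZc : Continuous Z := by fun_prop
  have hint : ∀ (g : (Fin n → unitInterval) → ℝ), Continuous g → Integrable g volume :=
    fun g hg => hg.integrable_of_compactSpace
  have hcp : ∀ k, Continuous fun x : Fin n → unitInterval => ∏ i, f k (x i) :=
    fun k => continuous_prod_apply (f k)
  have hZA : ∫ x in A, Z x ≤ b := by
    rw [hZ, integral_const_mul, integral_finsetSum _ fun k _ => (hint _ (hcp k)).integrableOn]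
    simp_rw [← sampleLaw_real_eq_setIntegral n (hf _)]
    rw [inv_mul_le_iff₀ hM0]
    calc ∑ k, (sampleLaw n (f k)).real A ≤ ∑ _k : ι, b := Finset.sum_le_sum fun k _ => hb k
      _ = M * b := by simp [hM]
  have hZ1 : ∫ x, Z x = 1 := by
    rw [hZ, integral_const_mul, integral_finsetSum _ fun k _ => hint _ (hcp k)]
    have : ∀ k, ∫ x : Fin n → unitInterval, ∏ i, f k (x i) = 1 := fun k => by
      rw [integral_fintype_prod_volume_eq_prod (fun _ => f k)]; simp [h1]
    simp only [this, Finset.sum_const, Finset.card_univ, nsmul_eq_mul, mul_one]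
    exact inv_mul_cancel₀ hM0.ne'
  -- By orthogonality each off-diagonal pair contributes `1`, and each diagonal one `(1 + v) ^ n`.
  have hZ2 : ∫ x, Z x ^ 2 = 1 + ((1 + v) ^ n - 1) / M := by
    have e1 : ∀ x, Z x ^ 2 = M⁻¹ ^ 2 * ∑ k, ∑ l, ∏ i, (f k (x i) * f l (x i)) := fun x => by
      simp only [hZ, Finset.prod_mul_distrib, ← Finset.sum_mul_sum]
      ring
    have e2 : ∀ k l, ∫ x : Fin n → unitInterval, ∏ i, (f k (x i) * f l (x i)) =
        1 + if k = l then (1 + v) ^ n - 1 else 0 := fun k l => by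
      rw [integral_fintype_prod_volume_eq_prod (fun _ y => f k y * f l y)]
      simp only [h2, Finset.prod_const, Finset.card_univ, Fintype.card_fin]
      split_ifs <;> simp
    simp_rw [e1]
    rw [integral_const_mul, integral_finsetSum _ fun k _ => hint _ (by fun_prop)]
    simp_rw [fun k : ι => integral_finsetSum (μ := (volume : Measure (Fin n → unitInterval)))
      Finset.univ (f := fun l x => ∏ i, (f k (x i) * f l (x i)))
      fun l _ => hint _ (by fun_prop), e2]
    simp only [Finset.sum_add_distrib, Finset.sum_const, Finset.card_univ, nsmul_eq_mul, mul_one,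
      Finset.sum_ite_eq, Finset.mem_univ, if_true, ← hM]
    field_simp
  have hV : ∫ x, |1 - Z x| ^ 2 = ((1 + v) ^ n - 1) / M := by
    have : ∀ x, |1 - Z x| ^ 2 = 1 - 2 * Z x + Z x ^ 2 := fun x => by rw [sq_abs]; ring
    simp_rw [this]
    rw [integral_add (hint _ (by fun_prop)) (hint _ (by fun_prop)),
      integral_sub (integrable_const _) (hint _ (by fun_prop)), integral_const_mul, hZ1, hZ2]
    simp
    ring
  have h3 : ∫ x, |1 - Z x| ≤ √(((1 + v) ^ n - 1) / M) := by
    refine Real.le_sqrt_of_sq_le ?_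
    rw [← hV]
    exact sq_integral_le_integral_sq (by fun_prop)
  have h4 : (volume : Measure (Fin n → unitInterval)).real A - ∫ x in A, Z x ≤
      ∫ x, |1 - Z x| := by
    calc _ = ∫ x in A, (1 - Z x) := by
          rw [integral_sub (integrable_const _) (hint _ hZc).integrableOn]
          simp
      _ ≤ ∫ x in A, |1 - Z x| := by
          refine integral_mono (hint _ (by fun_prop)).integrableOn
            (hint _ (by fun_prop)).integrableOn fun x => le_abs_self _
      _ ≤ ∫ x, |1 - Z x| := setIntegral_le_integral (hint _ (by fun_prop))
          (Eventually.of_forall fun x => abs_nonneg _)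
  linarith

/-- A confidence band which covers the uniform density and is then narrow, and which covers each
member `f k` of a family far from the uniform density, gives a test between them. -/
theorem ConfidenceBand.one_le_of_separated {ι : Type*} [Fintype ι] [Nonempty ι] [DecidableEq ι]
    {n : ℕ} (C : ConfidenceBand n) (f : ι → C(unitInterval, ℝ)) (hf : ∀ k x, 0 ≤ f k x)
    (h1 : ∀ k, ∫ x, f k x = 1)
    {v : ℝ} (h2 : ∀ k l, ∫ x, f k x * f l x = 1 + if k = l then v else 0)
    {a τ d : ℝ} (hτ : 0 < τ) (hd : 0 ≤ d) (hsep : ∀ k, τ ≤ ‖(1 : C(unitInterval, ℝ)) - f k‖)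
    (hdiam : C.expectedDiam 1 ≤ ENNReal.ofReal d)
    (hc0 : ENNReal.ofReal (1 - a) ≤ sampleLaw n 1 (C.cover 1))
    (hck : ∀ k, ENNReal.ofReal (1 - a) ≤ sampleLaw n (f k) (C.cover (f k))) :
    1 ≤ 2 * a + d / τ + √(((1 + v) ^ n - 1) / Fintype.card ι) := by
  set D : Set (Fin n → unitInterval) := {x | ENNReal.ofReal τ ≤ C.diam x}
  -- The test accepts uniformity on `A`: the band covers `1` and has diameter below `τ`, so it
  -- cannot also contain any `f k`.
  set A := C.cover 1 \ D
  have hA : (volume : Measure (Fin n → unitInterval)).real A ≤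
      a + √(((1 + v) ^ n - 1) / Fintype.card ι) := by
    refine volume_real_le_of_sampleLaw_real_le n f hf h1 h2 A fun k => ?_
    have := isProbabilityMeasure_sampleLaw n (hf k) (h1 k)
    have hdisj : Disjoint A (C.cover (f k)) := by
      rw [Set.disjoint_left]
      rintro x ⟨hx1, hxD⟩ hxk
      obtain ⟨y, hy⟩ : ∃ y, τ ≤ |1 - f k y| := by
        by_contra! hlt
        exact absurd (hsep k) (not_le.2 ((ContinuousMap.norm_lt_iff _ hτ).2 hlt))
      refine hxD ?_
      refine le_trans ?_ (le_iSup (fun y => ENNReal.ofReal |C.upper x y - C.lower x y|) y)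
      refine ENNReal.ofReal_le_ofReal (hy.trans ?_)
      have ha := hx1 y
      have hb := hxk y
      simp only [ContinuousMap.one_apply, mem_Icc] at ha hb
      rw [abs_le]
      have hw := le_abs_self (C.upper x y - C.lower x y)
      constructor <;> linarith
    have hm : NullMeasurableSet (C.cover (f k)) (sampleLaw n (f k)) :=
      (C.nullMeasurableSet_cover (f k)).mono_ac (sampleLaw_absolutelyContinuous n (hf k))
    have hu := measureReal_union₀ (μ := sampleLaw n (f k)) hm hdisj.aedisjoint
    have hle : (sampleLaw n (f k)).real (A ∪ C.cover (f k)) ≤ 1 := measureReal_le_one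
    have hk : 1 - a ≤ (sampleLaw n (f k)).real (C.cover (f k)) :=
      (ENNReal.ofReal_le_iff_le_toReal (measure_ne_top _ _)).1 (hck k)
    linarith
  rw [sampleLaw_one] at hc0
  have hc : 1 - a ≤ (volume : Measure (Fin n → unitInterval)).real (C.cover 1) :=
    (ENNReal.ofReal_le_iff_le_toReal (measure_ne_top _ _)).1 hc0
  -- Markov's inequality for the diameter.
  have hD : (volume : Measure (Fin n → unitInterval)).real D ≤ d / τ := by
    have hmk : ENNReal.ofReal τ * volume D ≤ ENNReal.ofReal d := by
      refine (mul_meas_ge_le_lintegral₀ C.aemeasurable_diam _).trans ?_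
      have := hdiam
      rwa [ConfidenceBand.expectedDiam, sampleLaw_one] at this
    have := ENNReal.toReal_mono ENNReal.ofReal_ne_top hmk
    rw [ENNReal.toReal_mul, ENNReal.toReal_ofReal hτ.le, ENNReal.toReal_ofReal hd] at this
    rw [le_div_iff₀ hτ, mul_comm]
    exact this
  have hsub : (volume : Measure (Fin n → unitInterval)).real (C.cover 1) ≤
      (volume : Measure (Fin n → unitInterval)).real A +
        (volume : Measure (Fin n → unitInterval)).real D := by
    refine (measureReal_mono ?_).trans (measureReal_union_le A D)
    intro x hx
    by_cases hxD : x ∈ D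
    · exact Or.inr hxD
    · exact Or.inl ⟨hx, hxD⟩
  linarith

/-! ## Wavelets on the interval -/

open Polynomial in
-- A dimension count: preimages of the `N` independent vectors form a basis of the `N`-dimensional
-- `degreeLT ℝ N`.
theorem apply_mem_span_of_linearIndependent {N : ℕ} {V : Type*} [AddCommGroup V] [Module ℝ V]
    (T : degreeLT ℝ N →ₗ[ℝ] V) {g : Fin N → V} (hg : LinearIndependent ℝ g)
    (hT : ∀ i, ∃ q, T q = g i) (p : degreeLT ℝ N) : T p ∈ Submodule.span ℝ (range g) := by
  choose q hq using hT
  have hgq : g = T ∘ q := funext fun i => (hq i).symm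
  have hli : LinearIndependent ℝ q := LinearIndependent.of_comp T (hgq ▸ hg)
  have hfd : FiniteDimensional ℝ (degreeLT ℝ N) :=
    (degreeLTEquiv ℝ N).symm.finiteDimensional
  have hspan := hli.span_eq_top_of_card_eq_finrank'
    (by rw [(degreeLTEquiv ℝ N).finrank_eq]; simp)
  have hp : p ∈ Submodule.span ℝ (range q) := hspan ▸ Submodule.mem_top
  rw [hgq, range_comp, ← Submodule.map_span]
  exact Submodule.mem_map_of_mem hp

open Polynomial in
/-- The combination `∑ₘ p(m) φ(2^j x - c - m)` of translates of `φ` as a function on the unit interval. -/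
def translateSum (N : ℕ) (φ : ℝ → ℝ) (j : ℕ) (c : ℝ) (I : Finset ℤ) :
    degreeLT ℝ N →ₗ[ℝ] (unitInterval → ℝ) where
  toFun p x := ∑ m ∈ I, (p : ℝ[X]).eval (m : ℝ) * φ (2 ^ j * (x : ℝ) - c - m)
  map_add' p q := by
    ext x
    simp [add_mul, Finset.sum_add_distrib]
  map_smul' a p := by
    ext x
    simp [mul_assoc, Finset.mul_sum]

namespace IntervalWaveletBasis

variable {S : ℕ} (W : IntervalWaveletBasis S)

theorem levelFun_scaling_of_left {j : ℕ} {k : Fin (2 ^ j)} (hk : (k : ℕ) < W.N) :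
    ∃ q, translateSum W.N W.φ j 0 (Finset.Icc (1 - (W.N : ℤ)) (W.N - 1)) q =
      levelFun W.N W.φ W.φL W.φR j k := by
  obtain ⟨q, hq, h⟩ := W.left_scaling k hk
  refine ⟨(2 : ℝ) ^ ((j : ℝ) / 2) • ⟨q, hq⟩, ?_⟩
  rw [map_smul]
  ext x
  have hx : (0 : ℝ) ≤ 2 ^ j * (x : ℝ) := mul_nonneg (by positivity) x.2.1
  simp [translateSum, levelFun, hk, h _ hx]

theorem levelFun_scaling_of_right {j : ℕ} {k : Fin (2 ^ j)} (hk : ¬ (k : ℕ) < W.N)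
    (hk' : ¬ (k : ℕ) + W.N < 2 ^ j) :
    ∃ q, translateSum W.N W.φ j (2 ^ j) (Finset.Icc (-(W.N : ℤ)) (W.N - 2)) q =
      levelFun W.N W.φ W.φL W.φR j k := by
  obtain ⟨q, hq, h⟩ := W.right_scaling (2 ^ j - 1 - (k : ℕ)) (by have := k.2; lia)
  refine ⟨(2 : ℝ) ^ ((j : ℝ) / 2) • ⟨q, hq⟩, ?_⟩
  rw [map_smul]
  ext x
  have hx : (2 : ℝ) ^ j * ((x : ℝ) - 1) ≤ 0 :=
    mul_nonpos_of_nonneg_of_nonpos (by positivity) (by linarith [x.2.2])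
  simp [translateSum, levelFun, hk, hk', h _ hx, ← mul_sub_one]

theorem continuous_translateSum {N : ℕ} {φ : ℝ → ℝ} (hφ : Continuous φ) (j : ℕ) (c : ℝ)
    (I : Finset ℤ) (q : Polynomial.degreeLT ℝ N) : Continuous (translateSum N φ j c I q) := by
  change Continuous fun x : unitInterval =>
    ∑ m ∈ I, (q : Polynomial ℝ).eval (m : ℝ) * φ (2 ^ j * (x : ℝ) - c - m)
  fun_prop

theorem continuous_levelFun_scaling (j : ℕ) (k : Fin (2 ^ j)) :
    Continuous (levelFun W.N W.φ W.φL W.φR j k) := by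
  have hφ := W.isDaubechies.continuous
  by_cases hk : (k : ℕ) < W.N
  · obtain ⟨q, hq⟩ := W.levelFun_scaling_of_left hk
    exact hq ▸ continuous_translateSum hφ _ _ _ q
  by_cases hk' : (k : ℕ) + W.N < 2 ^ j
  · have : levelFun W.N W.φ W.φL W.φR j k =
        fun x : unitInterval => (2 : ℝ) ^ ((j : ℝ) / 2) * W.φ (2 ^ j * (x : ℝ) - (k : ℕ)) := by
      ext x; simp [levelFun, hk, hk']
    rw [this]
    fun_prop
  · obtain ⟨q, hq⟩ := W.levelFun_scaling_of_right hk hk'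
    exact hq ▸ continuous_translateSum hφ _ _ _ q

theorem continuous_scaling (k : Fin (2 ^ W.J₀)) : Continuous (W.scaling k) :=
  W.continuous_levelFun_scaling _ k

/-- Edge wavelets have no regularity hypothesis of their own; they inherit continuity from the finer
scaling space. -/
theorem continuous_wavelet {l : ℕ} (hl : W.J₀ ≤ l) (k : Fin (2 ^ l)) :
    Continuous (W.wavelet l k) := by
  have h : W.wavelet l k ∈ Submodule.span ℝ (range (levelFun W.N W.φ W.φL W.φR (l + 1))) :=
    W.wavelet_mem_span l hl k
  generalize W.wavelet l k = g at h ⊢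
  induction h using Submodule.span_induction with
  | mem g hg => obtain ⟨i, rfl⟩ := hg; exact W.continuous_levelFun_scaling _ i
  | zero => exact continuous_const
  | add f g _ _ hf hg => exact hf.add hg
  | smul a f _ hf => exact hf.const_smul a

/-! ### Constants in the scaling space and mean zero of wavelets -/

theorem linearIndependent_scaling : LinearIndependent ℝ W.scaling := by
  rw [Fintype.linearIndependent_iff]
  intro c hc i
  have h1 : ∫ x, (∑ k, c k • W.scaling k) x * W.scaling i x = c i := by
    simp_rw [Finset.sum_apply, Finset.sum_mul, Pi.smul_apply, smul_eq_mul, mul_assoc]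
    rw [integral_finsetSum _ fun k _ =>
      (((W.continuous_scaling k).fun_mul (W.continuous_scaling i)).const_mul
        (c k)).integrable_of_compactSpace]
    simp_rw [integral_const_mul]
    have := fun k => W.scaling_orthonormal k i
    simp only [scaling, this]
    simp
  rw [← h1, hc]
  simp

/-- Split the partition of unity at `2^J x` into left, interior and right translates. The outer sums
are the edge combinations with polynomial `1`, and the `N` independent edge functions span all such
combinations. -/
theorem one_mem_span_scaling :
    (fun _ => 1 : unitInterval → ℝ) ∈ Submodule.span ℝ (range W.scaling) := by
  have hN := W.isDaubechies.order_pos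
  have h2N := W.two_mul_order_le
  set J := W.J₀
  have h1 : (1 : Polynomial ℝ) ∈ Polynomial.degreeLT ℝ W.N := by
    rw [Polynomial.mem_degreeLT, Polynomial.degree_one]
    exact_mod_cast hN
  set p : Polynomial.degreeLT ℝ W.N := ⟨1, h1⟩
  have hsub : ∀ e : Fin W.N → Fin (2 ^ J), Submodule.span ℝ (range (W.scaling ∘ e)) ≤
      Submodule.span ℝ (range W.scaling) := fun e =>
    Submodule.span_mono (range_comp_subset_range _ _)
  have hL : translateSum W.N W.φ J 0 (Finset.Icc (1 - (W.N : ℤ)) (W.N - 1)) p ∈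
      Submodule.span ℝ (range W.scaling) := by
    let e : Fin W.N → Fin (2 ^ J) := fun i => ⟨i, by have := i.2; lia⟩
    have he : Function.Injective e := fun a b hab => by simpa [e, Fin.ext_iff] using hab
    exact hsub e (apply_mem_span_of_linearIndependent _ (W.linearIndependent_scaling.comp e he)
      (fun i => W.levelFun_scaling_of_left (k := e i) i.2) p)
  have hR : translateSum W.N W.φ J (2 ^ J) (Finset.Icc (-(W.N : ℤ)) (W.N - 2)) p ∈
      Submodule.span ℝ (range W.scaling) := by
    let e : Fin W.N → Fin (2 ^ J) := fun i => ⟨2 ^ J - 1 - i, by have := i.2; lia⟩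
    have he : Function.Injective e := fun a b hab => by
      have := a.2
      have := b.2
      simp only [e, Fin.mk.injEq] at hab
      exact Fin.ext (by lia)
    refine hsub e (apply_mem_span_of_linearIndependent _ (W.linearIndependent_scaling.comp e he)
      (fun i => W.levelFun_scaling_of_right (k := e i) ?_ ?_) p)
    · have := i.2; simp only [e]; lia
    · have := i.2; simp only [e]; lia
  have hM : (∑ m ∈ Finset.Icc (W.N : ℤ) (2 ^ J - W.N - 1),
      fun x : unitInterval => W.φ (2 ^ J * (x : ℝ) - m)) ∈
        Submodule.span ℝ (range W.scaling) := by
    refine Submodule.sum_mem _ fun m hm => ?_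
    rw [Finset.mem_Icc] at hm
    obtain ⟨k, rfl⟩ := Int.eq_ofNat_of_zero_le (by lia : 0 ≤ m)
    have hk1 : W.N ≤ k := by lia
    have hk2 : k + W.N < 2 ^ J := by zify; lia
    have hc : (2 : ℝ) ^ ((J : ℝ) / 2) ≠ 0 := by positivity
    have : (fun x : unitInterval => W.φ (2 ^ J * (x : ℝ) - ((k : ℤ) : ℝ))) =
        ((2 : ℝ) ^ ((J : ℝ) / 2))⁻¹ • W.scaling ⟨k, by lia⟩ := by
      ext x
      simp only [scaling, levelFun, Pi.smul_apply, smul_eq_mul]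
      rw [if_neg (by simpa using hk1), if_pos (by simpa using hk2), inv_mul_cancel_left₀ hc,
        Int.cast_natCast]
    rw [this]
    exact Submodule.smul_mem _ _ (Submodule.subset_span (mem_range_self _))
  have hsum : (fun _ => 1 : unitInterval → ℝ) =
      translateSum W.N W.φ J 0 (Finset.Icc (1 - (W.N : ℤ)) (W.N - 1)) p +
      (∑ m ∈ Finset.Icc (W.N : ℤ) (2 ^ J - W.N - 1),
        fun x : unitInterval => W.φ (2 ^ J * (x : ℝ) - m)) +
      translateSum W.N W.φ J (2 ^ J) (Finset.Icc (-(W.N : ℤ)) (W.N - 2)) p := by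
    ext x
    have hu := W.isDaubechies.tsum_translates (2 ^ J * (x : ℝ))
    have hle : (2 : ℝ) ^ J * (x : ℝ) ≤ ((2 ^ J : ℤ) : ℝ) := by
      push_cast
      exact mul_le_of_le_one_right (by positivity) x.2.2
    rw [W.isDaubechies.tsum_translates_eq_sum (a := 0) (b := 2 ^ J)
      (by simpa using mul_nonneg (by positivity : (0 : ℝ) ≤ 2 ^ J) x.2.1) hle] at hu
    have h2N' : 2 * (W.N : ℤ) ≤ 2 ^ J := by exact_mod_cast h2N
    have hs : Finset.Icc ((0 : ℤ) + 1 - W.N) (2 ^ J + W.N - 1) =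
        (Finset.Icc (1 - (W.N : ℤ)) (W.N - 1) ∪ Finset.Icc (W.N : ℤ) (2 ^ J - W.N - 1)) ∪
          insert (2 ^ J + W.N - 1 : ℤ) (Finset.Icc (2 ^ J - W.N : ℤ) (2 ^ J + W.N - 2)) := by
      ext m
      simp only [Finset.mem_Icc, Finset.mem_union, Finset.mem_insert]
      lia
    have hshift : ∑ m ∈ Finset.Icc (2 ^ J - W.N : ℤ) (2 ^ J + W.N - 2),
        W.φ (2 ^ J * (x : ℝ) - m) =
        ∑ m ∈ Finset.Icc (-(W.N : ℤ)) (W.N - 2), W.φ (2 ^ J * (x : ℝ) - 2 ^ J - m) := by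
      refine Finset.sum_nbij' (fun m => m - 2 ^ J) (fun m => m + 2 ^ J) ?_ ?_ ?_ ?_ ?_
      · intro m hm; simp only [Finset.mem_Icc] at hm ⊢; lia
      · intro m hm; simp only [Finset.mem_Icc] at hm ⊢; lia
      · intro m _; ring
      · intro m _; ring
      · intro m _; push_cast; congr 1; ring
    -- The translate in excess of the right edge range has its support beginning at `x = 1`, so it
    -- vanishes on the unit interval.
    have hlast : W.φ (2 ^ J * (x : ℝ) - ((2 ^ J + W.N - 1 : ℤ) : ℝ)) = 0 := by
      apply W.isDaubechies.eq_zero_of_le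
      push_cast at hle ⊢
      linarith
    rw [hs, Finset.sum_union, Finset.sum_union, Finset.sum_insert, hlast, zero_add, hshift] at hu
    · simpa [translateSum, p] using hu.symm
    · simp only [Finset.mem_Icc]; lia
    · rw [Finset.disjoint_left]
      intro m
      simp only [Finset.mem_Icc]
      lia
    · rw [Finset.disjoint_left]
      intro m
      simp only [Finset.mem_Icc, Finset.mem_union, Finset.mem_insert]
      lia
  rw [hsum]
  exact Submodule.add_mem _ (Submodule.add_mem _ hL hM) hR

/-- Wavelets are orthogonal to the scaling space, which contains the constants. -/
theorem integral_wavelet {l : ℕ} (hl : W.J₀ ≤ l) (k : Fin (2 ^ l)) :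
    ∫ x, W.wavelet l k x = 0 := by
  have hw := W.continuous_wavelet hl k
  have key : ∀ g ∈ Submodule.span ℝ (range W.scaling),
      Continuous g ∧ ∫ x, g x * W.wavelet l k x = 0 := by
    intro g hg
    induction hg using Submodule.span_induction with
    | mem g hg =>
      obtain ⟨i, rfl⟩ := hg
      exact ⟨W.continuous_scaling i, W.scaling_wavelet_orthogonal i l hl k⟩
    | zero => exact ⟨continuous_const, by simp⟩
    | add f g _ _ hf hg =>
      refine ⟨hf.1.add hg.1, ?_⟩
      simp_rw [Pi.add_apply, add_mul]
      rw [integral_add (hf.1.fun_mul hw).integrable_of_compactSpace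
        (hg.1.fun_mul hw).integrable_of_compactSpace, hf.2, hg.2, add_zero]
    | smul a f _ hf =>
      refine ⟨hf.1.const_smul a, ?_⟩
      simp_rw [Pi.smul_apply, smul_eq_mul, mul_assoc]
      rw [integral_const_mul, hf.2, mul_zero]
  simpa using (key _ W.one_mem_span_scaling).2

theorem abs_integral_scaling_le (k : Fin (2 ^ W.J₀)) : |∫ x, W.scaling k x| ≤ 1 := by
  rw [← sq_le_one_iff_abs_le_one]
  refine (sq_integral_le_integral_sq (W.continuous_scaling k)).trans ?_
  have := W.scaling_orthonormal k k
  rw [if_pos rfl] at this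
  simp_rw [sq]
  exact this.le

/-! ## Wavelet perturbations of the uniform density -/

theorem wavelet_eq_of_interior {l : ℕ} {k : Fin (2 ^ l)} (hk : W.N ≤ k) (hk' : (k : ℕ) + W.N < 2 ^ l)
    (x : unitInterval) : W.wavelet l k x =
      (2 : ℝ) ^ ((l : ℝ) / 2) * motherWavelet W.N W.h W.φ (2 ^ l * (x : ℝ) - (k : ℕ)) := by
  simp [wavelet, levelFun, not_lt.2 hk, hk']

theorem exists_motherWavelet_le :
    ∃ M : ℝ, 0 < M ∧ ∀ x, |motherWavelet W.N W.h W.φ x| ≤ M := by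
  obtain ⟨M, hM⟩ := W.isDaubechies.continuous_motherWavelet.bounded_above_of_compact_support
    W.isDaubechies.hasCompactSupport_motherWavelet
  exact ⟨max M 1, by positivity, fun x => (hM x).trans (le_max_left _ _)⟩

/-- Rescale after enlarging the domain of integration to the whole line. -/
theorem integral_abs_wavelet_le {l : ℕ} {k : Fin (2 ^ l)} (hk : W.N ≤ k)
    (hk' : (k : ℕ) + W.N < 2 ^ l) :
    ∫ x, |W.wavelet l k x| ≤
      (2 : ℝ) ^ (-((l : ℝ) / 2)) * ∫ x, |motherWavelet W.N W.h W.φ x| := by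
  have hi : Integrable fun x => |motherWavelet W.N W.h W.φ x| :=
    (W.isDaubechies.continuous_motherWavelet.integrable_of_hasCompactSupport
      W.isDaubechies.hasCompactSupport_motherWavelet).abs
  set F : ℝ → ℝ := fun x => |motherWavelet W.N W.h W.φ x|
  have hpos : (0 : ℝ) < 2 ^ l := by positivity
  have h1 : ∀ x : unitInterval, |W.wavelet l k x| =
      (2 : ℝ) ^ ((l : ℝ) / 2) * F (2 ^ l * (x : ℝ) - (k : ℕ)) := fun x => by
    rw [W.wavelet_eq_of_interior hk hk', abs_mul, abs_of_pos (by positivity)]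
  simp_rw [h1]
  rw [integral_const_mul]
  have hi' : Integrable fun x : ℝ => F (2 ^ l * x - (k : ℕ)) :=
    (hi.comp_sub_right ((k : ℕ) : ℝ)).comp_mul_left' hpos.ne'
  have h2 : ∫ x : unitInterval, F (2 ^ l * (x : ℝ) - (k : ℕ)) ≤ (2 ^ l)⁻¹ * ∫ x, F x := by
    rw [unitInterval.measurePreserving_coe.integral_comp unitInterval.measurableEmbedding_coe
      (fun x : ℝ => F (2 ^ l * x - (k : ℕ)))]
    refine (setIntegral_le_integral hi' (Eventually.of_forall fun x => abs_nonneg _)).trans_eq ?_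
    rw [Measure.integral_comp_mul_left (fun y => F (y - (k : ℕ))) ((2 : ℝ) ^ l),
      integral_sub_right_eq_self F, abs_of_pos (inv_pos.2 hpos), smul_eq_mul]
  refine (mul_le_mul_of_nonneg_left h2 (by positivity)).trans_eq ?_
  rw [← mul_assoc]
  congr 1
  rw [← Real.rpow_natCast, ← Real.rpow_neg zero_le_two, ← Real.rpow_add two_pos]
  congr 1
  ring

/-- The perturbation `1 + a ψ_{lk}` of the uniform density. -/
def bump {l : ℕ} (hl : W.J₀ ≤ l) (k : Fin (2 ^ l)) (a : ℝ) : C(unitInterval, ℝ) :=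
  ⟨fun x => 1 + a * W.wavelet l k x, by have := W.continuous_wavelet hl k; fun_prop⟩

variable {l : ℕ} (hl : W.J₀ ≤ l) (k : Fin (2 ^ l)) (a : ℝ)

theorem bump_zero : W.bump hl k 0 = 1 := by
  ext x
  simp [bump]

theorem integral_bump_mul {g : unitInterval → ℝ} (hg : Continuous g) :
    ∫ x, W.bump hl k a x * g x = (∫ x, g x) + a * ∫ x, W.wavelet l k x * g x := by
  have hw := W.continuous_wavelet hl k
  simp only [bump, ContinuousMap.coe_mk, add_mul, one_mul, mul_assoc]
  rw [integral_add hg.integrable_of_compactSpace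
    ((hw.fun_mul hg).const_mul a).integrable_of_compactSpace, integral_const_mul]

theorem integral_bump : ∫ x, W.bump hl k a x = 1 := by
  have := W.integral_bump_mul hl k a (g := fun _ => 1) continuous_const
  simpa [W.integral_wavelet hl k] using this

/-- Orthonormality and mean zero give the Gram matrix needed for the chi-square bound, with `v = a ^
2`. -/
theorem integral_bump_mul_bump (k' : Fin (2 ^ l)) :
    ∫ x, W.bump hl k a x * W.bump hl k' a x = 1 + if k = k' then a ^ 2 else 0 := by
  have hw := W.continuous_wavelet hl k
  rw [W.integral_bump_mul hl k a (W.bump hl k' a).continuous, integral_bump]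
  simp_rw [mul_comm (W.wavelet l k _)]
  rw [W.integral_bump_mul hl k' a hw, W.integral_wavelet hl k]
  have := W.wavelet_orthonormal l hl k' k
  rw [show ∫ x, W.wavelet l k' x * W.wavelet l k x = if k' = k then 1 else 0 from this]
  simp only [eq_comm (a := k')]
  split_ifs <;> ring

theorem scalingCoeff_bump (i : Fin (2 ^ W.J₀)) :
    W.scalingCoeff (W.bump hl k a) i = ∫ x, W.scaling i x := by
  rw [scalingCoeff, W.integral_bump_mul hl k a (W.continuous_scaling i)]
  simp_rw [mul_comm (W.wavelet l k _)]
  rw [show ∫ x, W.scaling i x * W.wavelet l k x = 0 from W.scaling_wavelet_orthogonal i l hl k]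
  simp

theorem waveletCoeff_bump_self (k' : Fin (2 ^ l)) :
    W.waveletCoeff (W.bump hl k a) l k' = if k = k' then a else 0 := by
  rw [waveletCoeff, W.integral_bump_mul hl k a (W.continuous_wavelet hl k'),
    W.integral_wavelet hl k', show ∫ x, W.wavelet l k x * W.wavelet l k' x = if k = k' then 1 else 0
      from W.wavelet_orthonormal l hl k k']
  split_ifs <;> simp

theorem waveletCoeff_bump_of_ne {l' : ℕ} (hl' : W.J₀ ≤ l') (hne : l ≠ l') (k' : Fin (2 ^ l')) :
    W.waveletCoeff (W.bump hl k a) l' k' = 0 := by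
  rw [waveletCoeff, W.integral_bump_mul hl k a (W.continuous_wavelet hl' k'),
    W.integral_wavelet hl' k', show ∫ x, W.wavelet l k x * W.wavelet l' k' x = 0
      from W.wavelet_orthogonal l l' hl hl' hne k k']
  simp

/-- A single wavelet coefficient is nonzero, and the scaling coefficients are those of the uniform
density, at most `1 ≤ B`. -/
theorem bump_mem_densityBall {B s : ℝ} (hB : 1 ≤ B) (hpos : ∀ x, 0 ≤ W.bump hl k a x)
    (ha : (2 : ℝ) ^ ((l : ℝ) * (s + 1 / 2)) * |a| ≤ B) :
    W.bump hl k a ∈ W.densityBall B s := by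
  refine ⟨hpos, W.integral_bump hl k a, max_le (iSup_le fun i => ?_)
    (iSup_le fun l' => iSup_le fun hl' => iSup_le fun k' => ?_)⟩
  · rw [W.scalingCoeff_bump]
    exact ENNReal.ofReal_le_ofReal ((W.abs_integral_scaling_le i).trans hB)
  · refine ENNReal.ofReal_le_ofReal ?_
    rcases eq_or_ne l l' with rfl | hne
    · rw [W.waveletCoeff_bump_self]
      split_ifs
      · exact ha
      · simpa using zero_le_one.trans hB
    · rw [W.waveletCoeff_bump_of_ne hl k a hl' hne]
      simpa using zero_le_one.trans hB

theorem one_mem_densityBall {B : ℝ} (hB : 1 ≤ B) (s : ℝ) :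
    (1 : C(unitInterval, ℝ)) ∈ W.densityBall B s := by
  rw [← W.bump_zero le_rfl ⟨0, by positivity⟩]
  refine W.bump_mem_densityBall le_rfl _ 0 hB (fun x => by simp [bump_zero]) ?_
  simpa using zero_le_one.trans hB

/-! ### Wavelet coefficients against Hölder and sup norms -/

include hl

theorem waveletCoeff_one : W.waveletCoeff 1 l k = 0 := by
  rw [← W.bump_zero hl k, W.waveletCoeff_bump_self]
  simp

theorem abs_waveletCoeff_le_of_mem_densityBall {B t : ℝ} (hB : 0 ≤ B) {g : C(unitInterval, ℝ)}
    (hg : g ∈ W.densityBall B t) :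
    |W.waveletCoeff g l k| ≤ B * (2 : ℝ) ^ (-((l : ℝ) * (t + 1 / 2))) := by
  have h1 := ((le_max_right _ _).trans hg.2.2 :
    (⨆ (l : ℕ) (_ : W.J₀ ≤ l) (k : Fin (2 ^ l)), _) ≤ ENNReal.ofReal B)
  have h2 := (ENNReal.ofReal_le_ofReal_iff hB).1 (iSup_le_iff.1 (iSup₂_le_iff.1 h1 l hl) k)
  have hp : (0 : ℝ) < 2 ^ ((l : ℝ) * (t + 1 / 2)) := by positivity
  rw [Real.rpow_neg zero_le_two, ← div_eq_mul_inv, le_div_iff₀ hp, mul_comm]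
  exact h2

/-- Duality of sup norm and `L¹` norm: a gap in one coefficient forces separation in sup norm. -/
theorem abs_waveletCoeff_sub_le (f g : C(unitInterval, ℝ)) {k : Fin (2 ^ l)} (hk : W.N ≤ k)
    (hk' : (k : ℕ) + W.N < 2 ^ l) :
    |W.waveletCoeff f l k - W.waveletCoeff g l k| ≤
      ‖f - g‖ * ((2 : ℝ) ^ (-((l : ℝ) / 2)) * ∫ x, |motherWavelet W.N W.h W.φ x|) := by
  have hw := W.continuous_wavelet hl k
  have h1 : W.waveletCoeff f l k - W.waveletCoeff g l k =
      ∫ x, (f - g) x * W.wavelet l k x := by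
    rw [waveletCoeff, waveletCoeff, ← integral_sub
      (f.continuous.fun_mul hw).integrable_of_compactSpace
      (g.continuous.fun_mul hw).integrable_of_compactSpace]
    simp [sub_mul]
  rw [h1]
  refine (abs_integral_le_integral_abs).trans ?_
  refine le_trans ?_ (mul_le_mul_of_nonneg_left (W.integral_abs_wavelet_le hk hk')
    (norm_nonneg (f - g)))
  rw [← integral_const_mul]
  refine integral_mono ((f - g).continuous.mul hw).abs.integrable_of_compactSpace
    (hw.abs.const_mul _).integrable_of_compactSpace fun x => ?_
  change |(f - g) x * W.wavelet l k x| ≤ ‖f - g‖ * |W.wavelet l k x|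
  rw [abs_mul]
  exact mul_le_mul_of_nonneg_right ((f - g).norm_coe_le_norm x) (abs_nonneg _)

end IntervalWaveletBasis

/-! ## The lower bound -/

theorem two_rpow_natCast_mul (l : ℕ) (z : ℝ) :
    (2 : ℝ) ^ ((l : ℝ) * z) = Real.exp (l * Real.log 2 * z) := by
  rw [Real.rpow_def_of_pos two_pos]
  congr 1
  ring

theorem rate_eq_exp {n : ℕ} (hn : 1 < n) (s : ℝ) :
    rate n s = Real.exp (-(Real.log (n / Real.log n) * (s / (2 * s + 1)))) := by
  have h1 : 0 < Real.log n := Real.log_pos (by exact_mod_cast hn)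
  have h2 : (0 : ℝ) < n := by positivity
  rw [rate, Real.rpow_def_of_pos (by positivity), ← inv_div (n : ℝ), Real.log_inv, neg_mul]

/-- The grid condition concerns neighbours only; apply it to `s` and its successor, which is at most
`t`. -/
theorem IsGrid.div_log_le_sub {r R ζ : ℝ} {n : ℕ} {G : Finset ℝ} (hG : IsGrid r R ζ n G) {s t : ℝ}
    (hs : s ∈ G) (ht : t ∈ G) (hst : s < t) : ζ / Real.log n ≤ t - s := by
  have hne : (G.filter (s < ·)).Nonempty := ⟨t, by simp [ht, hst]⟩
  set v := (G.filter (s < ·)).min' hne with hv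
  have hvm := Finset.min'_mem _ hne
  rw [← hv, Finset.mem_filter] at hvm
  have hvt : v ≤ t := Finset.min'_le _ _ (by simp [ht, hst])
  have := (hG.spacing s hs v hvm.1 hvm.2 fun w hw ⟨h1, h2⟩ =>
    absurd (Finset.min'_le _ w (by simp [hw, h1])) (not_le.2 h2)).1
  linarith

theorem exists_level {x : ℝ} (hx : 0 ≤ x) :
    ∃ l : ℕ, x ≤ l * Real.log 2 ∧ l * Real.log 2 ≤ x + Real.log 2 := by
  have h2 : 0 < Real.log 2 := Real.log_pos one_lt_two
  refine ⟨⌈x / Real.log 2⌉₊, ?_, ?_⟩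
  · rw [← div_le_iff₀ h2]
    exact Nat.le_ceil _
  · have := (Nat.ceil_lt_add_one (div_nonneg hx h2.le)).le
    calc _ ≤ (x / Real.log 2 + 1) * Real.log 2 := mul_le_mul_of_nonneg_right this h2.le
      _ = _ := by field_simp

/-! ### Positivity and separation of the bumps -/

namespace IntervalWaveletBasis

variable {S : ℕ} (W : IntervalWaveletBasis S)

/-- The perturbation has sup norm at most `ε M 2^{-ls} ≤ 1`. -/
theorem bump_nonneg {M : ℝ} (hM : ∀ x, |motherWavelet W.N W.h W.φ x| ≤ M) {l : ℕ} (hl : W.J₀ ≤ l)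
    {k : Fin (2 ^ l)} (hk : W.N ≤ k) (hk' : (k : ℕ) + W.N < 2 ^ l) {ε s : ℝ} (hε : 0 ≤ ε)
    (h : ε * M ≤ Real.exp (l * Real.log 2 * s)) (x : unitInterval) :
    0 ≤ W.bump hl k (ε * (2 : ℝ) ^ (-((l : ℝ) * (s + 1 / 2)))) x := by
  change 0 ≤ 1 + ε * (2 : ℝ) ^ (-((l : ℝ) * (s + 1 / 2))) * W.wavelet l k x
  rw [W.wavelet_eq_of_interior hk hk']
  set m := motherWavelet W.N W.h W.φ (2 ^ l * (x : ℝ) - (k : ℕ))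
  have h1 : ε * (2 : ℝ) ^ (-((l : ℝ) * (s + 1 / 2))) * ((2 : ℝ) ^ ((l : ℝ) / 2) * m) =
      ε * m * Real.exp (-(l * Real.log 2 * s)) := by
    rw [show -((l : ℝ) * (s + 1 / 2)) = l * (-(s + 1 / 2)) by ring,
      show (l : ℝ) / 2 = l * (1 / 2) by ring, two_rpow_natCast_mul, two_rpow_natCast_mul,
      show -(l * Real.log 2 * s) = l * Real.log 2 * (-(s + 1 / 2)) + l * Real.log 2 * (1 / 2) by ring,
      Real.exp_add]
    ring
  have h2 : -(ε * M) ≤ ε * m := by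
    have := (abs_le.1 (hM (2 ^ l * (x : ℝ) - (k : ℕ)))).1
    calc -(ε * M) = ε * -M := by ring
      _ ≤ ε * m := mul_le_mul_of_nonneg_left this hε
  have h3 := Real.exp_pos (-(l * Real.log 2 * s))
  have h4 : Real.exp (l * Real.log 2 * s) * Real.exp (-(l * Real.log 2 * s)) = 1 := by
    rw [← Real.exp_add]; simp
  rw [h1]
  nlinarith

/-- At least half the bump's coefficient remains in the difference; dividing by the wavelet's `L¹`
norm, of order `2^{-l/2}`, leaves `2^{-ls}`. -/
theorem le_norm_sub_bump {l : ℕ} (hl : W.J₀ ≤ l) {k : Fin (2 ^ l)} (hk : W.N ≤ k)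
    (hk' : (k : ℕ) + W.N < 2 ^ l) {ε s : ℝ} {g : C(unitInterval, ℝ)}
    (hg : |W.waveletCoeff g l k| ≤ ε / 2 * (2 : ℝ) ^ (-((l : ℝ) * (s + 1 / 2)))) :
    ε / 2 * Real.exp (-(l * Real.log 2 * s)) ≤
      ‖g - W.bump hl k (ε * (2 : ℝ) ^ (-((l : ℝ) * (s + 1 / 2))))‖ *
        ∫ x, |motherWavelet W.N W.h W.φ x| := by
  have h1 := W.abs_waveletCoeff_sub_le hl g
    (W.bump hl k (ε * (2 : ℝ) ^ (-((l : ℝ) * (s + 1 / 2))))) hk hk'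
  rw [W.waveletCoeff_bump_self, if_pos rfl] at h1
  set D := ‖g - W.bump hl k (ε * (2 : ℝ) ^ (-((l : ℝ) * (s + 1 / 2))))‖
  have e1 : (2 : ℝ) ^ (-((l : ℝ) * (s + 1 / 2))) =
      Real.exp (-(l * Real.log 2 * s)) * (2 : ℝ) ^ (-((l : ℝ) / 2)) := by
    rw [show -((l : ℝ) * (s + 1 / 2)) = l * (-(s + 1 / 2)) by ring,
      show -((l : ℝ) / 2) = l * (-(1 / 2)) by ring, two_rpow_natCast_mul, two_rpow_natCast_mul,
      ← Real.exp_add]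
    congr 1
    ring
  have hp : (0 : ℝ) < 2 ^ (-((l : ℝ) / 2)) := by positivity
  rw [e1] at h1 hg
  have h2 := (abs_le.1 hg).2
  have h3 := (abs_le.1 h1).1
  refine le_of_mul_le_mul_right ?_ hp
  linarith

end IntervalWaveletBasis

/-- The lower bound for a fixed sample size. Here `x = log (n / log n)`. -/
theorem one_le_of_band {S : ℕ} (W : IntervalWaveletBasis S) {B M ε s s' r R a c δ η ρ L ζ x : ℝ} {n : ℕ}
    (hB : 1 ≤ B) (hM : ∀ x, |motherWavelet W.N W.h W.φ x| ≤ M) (hε : 0 < ε) (hε1 : ε ≤ 1)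
    (hn : 1 < n) (hx : x = Real.log (n / Real.log n)) (hx0 : Real.log n / 2 ≤ x)
    (hr : 0 < r) (hrs : r ≤ s) (hsR : s ≤ R) (hs'R : s' ≤ R) (hss' : s < s') (hζ : 0 < ζ)
    (hlevel : (2 : ℝ) ^ (W.J₀ + 1) ≤ Real.exp (x / (2 * R + 1)))
    (hpos : M ≤ Real.exp (x * (r / (2 * R + 1))))
    (hc : c = ε / 2 * Real.exp (-(R * Real.log 2)) / ((∫ x, |motherWavelet W.N W.h W.φ x|) + 1))
    (hζ1 : B * Real.exp (-(ζ / (2 * (2 * R + 1)))) ≤ ε / 2)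
    (hζ2 : L * Real.exp (-(ζ / (2 * (2 * R + 1) ^ 2))) ≤ δ * c)
    (hchi : √(2 * Real.exp (ε ^ 2 * Real.log n - x / (2 * R + 1))) ≤ η)
    (hL : 0 ≤ L) (hρ : ρ ≤ c * rate n s) {G : Finset ℝ} (hG : IsGrid r R ζ n G) (hs : s ∈ G)
    (hs' : s' ∈ G) (C : ConfidenceBand n)
    (hcov : ∀ f ∈ W.densityBall B s' ∪ W.separatedBall B s ρ G,
      ENNReal.ofReal (1 - a) ≤ sampleLaw n f (C.cover f))
    (hdiam : ∀ f ∈ W.densityBall B s', C.expectedDiam f ≤ ENNReal.ofReal (L * rate n s')) :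
    1 ≤ 2 * a + δ + η := by
  set K := ∫ x, |motherWavelet W.N W.h W.φ x| with hK
  have hK0 : 0 ≤ K := integral_nonneg fun x => abs_nonneg _
  have hlogn : 0 < Real.log n := Real.log_pos (by exact_mod_cast hn)
  have hx1 : 0 < x := by linarith
  have hs0 : 0 < s := hr.trans_le hrs
  have hR0 : 0 < R := hs0.trans_le hsR
  have hlog2 : 0 < Real.log 2 := Real.log_pos one_lt_two
  have hc0 : 0 < c := by rw [hc]; positivity
  have hr_pos : 0 < rate n s := by rw [rate_eq_exp hn]; positivity
  -- Up to rounding, `2^{l(2s+1)} = n / log n`.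
  obtain ⟨l, hl1, hl2⟩ := exists_level (x := x / (2 * s + 1)) (by positivity)
  set Λ := (l : ℝ) * Real.log 2 with hΛ
  have hexpΛ : Real.exp Λ = 2 ^ l := by
    have := two_rpow_natCast_mul l 1
    rw [mul_one, mul_one, Real.rpow_natCast] at this
    exact this.symm
  have hΛR : x / (2 * R + 1) ≤ Λ :=
    (div_le_div_of_nonneg_left hx1.le (by positivity) (by linarith)).trans hl1
  have hΛ0 : 0 < Λ := lt_of_lt_of_le (by positivity) hΛR
  have hJl : W.J₀ + 1 ≤ l := by
    have h1 : (2 : ℝ) ^ (W.J₀ + 1) ≤ 2 ^ l := by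
      rw [← hexpΛ]
      exact hlevel.trans (Real.exp_le_exp.2 hΛR)
    exact (pow_le_pow_iff_right₀ one_lt_two).1 h1
  have hl : W.J₀ ≤ l := by lia
  -- One level above `J₀` makes at least half of the indices interior.
  have h4N : 4 * W.N ≤ 2 ^ l := by
    have h1 := W.two_mul_order_le
    have h2 : 2 ^ (W.J₀ + 1) ≤ 2 ^ l := Nat.pow_le_pow_right two_pos hJl
    rw [pow_succ] at h2
    lia
  have hNpos := W.isDaubechies.order_pos
  set m := 2 ^ l - 2 * W.N with hm
  have hm0 : 0 < m := by lia
  have : Nonempty (Fin m) := ⟨⟨0, hm0⟩⟩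
  let e : Fin m → Fin (2 ^ l) := fun i => ⟨i + W.N, by have := i.2; lia⟩
  have he : Function.Injective e := fun i j hij => by simpa [e, Fin.ext_iff] using hij
  have he1 : ∀ i, W.N ≤ (e i : ℕ) := fun i => Nat.le_add_left _ _
  have he2 : ∀ i, (e i : ℕ) + W.N < 2 ^ l := fun i => by have := i.2; simp only [e]; lia
  set b : ℝ := ε * (2 : ℝ) ^ (-((l : ℝ) * (s + 1 / 2))) with hb
  have hb0 : 0 < b := by positivity
  set f : Fin m → C(unitInterval, ℝ) := fun i => W.bump hl (e i) b with hf
  have hM0 : 0 ≤ M := (abs_nonneg _).trans (hM 0)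
  have hf0 : ∀ i y, 0 ≤ f i y := fun i y => by
    refine W.bump_nonneg hM hl (he1 i) (he2 i) hε.le ?_ y
    refine (mul_le_of_le_one_left hM0 hε1).trans (hpos.trans (Real.exp_le_exp.2 ?_))
    calc x * (r / (2 * R + 1)) = x / (2 * R + 1) * r := by ring
      _ ≤ Λ * s := mul_le_mul hΛR hrs hr.le hΛ0.le
  have hfB : ∀ i, f i ∈ W.densityBall B s := fun i => by
    refine W.bump_mem_densityBall hl (e i) b hB (hf0 i) ?_
    rw [abs_of_pos hb0, hb, mul_left_comm, ← Real.rpow_add two_pos, add_neg_cancel, Real.rpow_zero,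
      mul_one]
    linarith
  -- Rounding `l` up costs at most a factor `2^{-R}`, which is built into `c`.
  have hexp : c * rate n s ≤ ε / 2 * Real.exp (-(Λ * s)) / (K + 1) := by
    rw [hc, div_mul_eq_mul_div, mul_assoc, rate_eq_exp hn, ← hx, ← Real.exp_add]
    gcongr
    have h1 : Λ * s ≤ (x / (2 * s + 1) + Real.log 2) * s := mul_le_mul_of_nonneg_right hl2 hs0.le
    have h2 : s * Real.log 2 ≤ R * Real.log 2 := mul_le_mul_of_nonneg_right hsR hlog2.le
    have h3 : (x / (2 * s + 1) + Real.log 2) * s = x * (s / (2 * s + 1)) + s * Real.log 2 := by ring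
    linarith
  have hfar : ∀ i (g : C(unitInterval, ℝ)),
      |W.waveletCoeff g l (e i)| ≤ ε / 2 * (2 : ℝ) ^ (-((l : ℝ) * (s + 1 / 2))) →
      c * rate n s ≤ ‖g - f i‖ := fun i g hg => by
    refine hexp.trans ?_
    rw [div_le_iff₀ (by positivity)]
    refine (W.le_norm_sub_bump hl (he1 i) (he2 i) hg).trans ?_
    exact mul_le_mul_of_nonneg_left (by linarith) (norm_nonneg _)
  -- The factor `log n` in `x` cancels the one in the grid spacing, leaving a gap governed by `ζ`
  -- alone.
  have hgap : ∀ {t}, t ∈ G → s < t → ζ / 2 ≤ (t - s) * x := fun {t} ht hst => by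
    have h1 := hG.div_log_le_sub hs ht hst
    have h2 : ζ / Real.log n * (Real.log n / 2) ≤ (t - s) * x :=
      mul_le_mul h1 hx0 (by positivity) (by linarith)
    have h3 : ζ / Real.log n * (Real.log n / 2) = ζ / 2 := by field_simp
    linarith
  have hsep : ∀ i, f i ∈ W.separatedBall B s ρ G := fun i => by
    refine ⟨hfB i, fun t ht hst g hg => hρ.trans (hfar i g ?_)⟩
    refine (W.abs_waveletCoeff_le_of_mem_densityBall hl (e i) (by linarith) hg).trans ?_
    have h1 : (2 : ℝ) ^ (-((l : ℝ) * (t + 1 / 2))) =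
        Real.exp (-(Λ * (t - s))) * (2 : ℝ) ^ (-((l : ℝ) * (s + 1 / 2))) := by
      rw [show -((l : ℝ) * (t + 1 / 2)) = l * (-(t + 1 / 2)) by ring,
        show -((l : ℝ) * (s + 1 / 2)) = l * (-(s + 1 / 2)) by ring, two_rpow_natCast_mul,
        two_rpow_natCast_mul, ← Real.exp_add]
      congr 1
      ring
    rw [h1, ← mul_assoc]
    refine mul_le_mul_of_nonneg_right (le_trans ?_ hζ1) (by positivity)
    refine mul_le_mul_of_nonneg_left (Real.exp_le_exp.2 (neg_le_neg ?_)) (by linarith)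
    calc ζ / (2 * (2 * R + 1)) = ζ / 2 / (2 * R + 1) := by field_simp
      _ ≤ (t - s) * x / (2 * R + 1) := div_le_div_of_nonneg_right (hgap ht hst) (by positivity)
      _ = x / (2 * R + 1) * (t - s) := by ring
      _ ≤ Λ * (t - s) := mul_le_mul_of_nonneg_right hΛR (by linarith)
  have h1B := W.one_mem_densityBall hB s'
  have hmain := C.one_le_of_separated f hf0 (fun i => W.integral_bump hl (e i) b) (v := b ^ 2)
    (fun i j => by
      have := W.integral_bump_mul_bump hl (e i) b (e j)
      simpa only [he.eq_iff] using this)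
    (a := a) (τ := c * rate n s) (d := L * rate n s') (by positivity)
    (mul_nonneg hL (by rw [rate_eq_exp hn]; positivity))
    (fun i => hfar i 1 (by rw [W.waveletCoeff_one hl, abs_zero]; positivity))
    (hdiam 1 h1B) (hcov 1 (Or.inl h1B)) (fun i => hcov _ (Or.inr (hsep i)))
  have hd : L * rate n s' / (c * rate n s) ≤ δ := by
    rw [div_le_iff₀ (by positivity), ← mul_assoc]
    -- The exponent `u / (2u + 1)` increases with slope at least `1 / (2R + 1)²`.
    have h1 : rate n s' ≤ Real.exp (-(ζ / (2 * (2 * R + 1) ^ 2))) * rate n s := by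
      rw [rate_eq_exp hn, rate_eq_exp hn, ← hx, ← Real.exp_add, Real.exp_le_exp]
      have h2 : s' / (2 * s' + 1) - s / (2 * s + 1) =
          (s' - s) / ((2 * s' + 1) * (2 * s + 1)) := by
        rw [div_sub_div _ _ (by linarith) (by linarith)]
        congr 1
        ring
      have h3 : (s' - s) / (2 * R + 1) ^ 2 ≤ (s' - s) / ((2 * s' + 1) * (2 * s + 1)) := by
        refine div_le_div_of_nonneg_left (by linarith) (mul_pos (by linarith) (by linarith)) ?_
        rw [sq]
        exact mul_le_mul (by linarith) (by linarith) (by linarith) (by linarith)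
      have h4 : ζ / (2 * (2 * R + 1) ^ 2) ≤ x * ((s' - s) / (2 * R + 1) ^ 2) := by
        calc ζ / (2 * (2 * R + 1) ^ 2) = ζ / 2 / (2 * R + 1) ^ 2 := by field_simp
          _ ≤ (s' - s) * x / (2 * R + 1) ^ 2 :=
            div_le_div_of_nonneg_right (hgap hs' hss') (by positivity)
          _ = _ := by ring
      have h5 := mul_le_mul_of_nonneg_left h3 hx1.le
      rw [← h2, mul_sub] at h5
      linarith
    calc L * rate n s' ≤ L * (Real.exp (-(ζ / (2 * (2 * R + 1) ^ 2))) * rate n s) :=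
          mul_le_mul_of_nonneg_left h1 hL
      _ = L * Real.exp (-(ζ / (2 * (2 * R + 1) ^ 2))) * rate n s := by ring
      _ ≤ δ * c * rate n s := mul_le_mul_of_nonneg_right hζ2 hr_pos.le
  -- Here `(1 + b²)^n ≤ n^{ε²}`, while there are at least `2^l / 2` bumps.
  have hv : √(((1 + b ^ 2) ^ n - 1) / Fintype.card (Fin m)) ≤ η := by
    refine le_trans (Real.sqrt_le_sqrt ?_) hchi
    have hn0 : (0 : ℝ) < n := by positivity
    have hb2 : n * b ^ 2 ≤ ε ^ 2 * Real.log n := by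
      have h1 : b ^ 2 = ε ^ 2 * Real.exp (-(Λ * (2 * s + 1))) := by
        rw [hb, mul_pow, show -((l : ℝ) * (s + 1 / 2)) = l * (-(s + 1 / 2)) by ring,
          two_rpow_natCast_mul, ← Real.exp_nat_mul]
        congr 2
        push_cast
        ring
      have h2 : x ≤ Λ * (2 * s + 1) := (div_le_iff₀ (by positivity)).1 hl1
      have h3 : Real.exp (-(Λ * (2 * s + 1))) ≤ Real.log n / n := by
        refine (Real.exp_le_exp.2 (neg_le_neg h2)).trans_eq ?_
        rw [hx, Real.exp_neg, Real.exp_log (by positivity), inv_div]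
      rw [h1]
      calc n * (ε ^ 2 * Real.exp (-(Λ * (2 * s + 1)))) ≤ n * (ε ^ 2 * (Real.log n / n)) := by gcongr
        _ = _ := by field_simp
    have hpow : (1 + b ^ 2) ^ n ≤ Real.exp (ε ^ 2 * Real.log n) := by
      calc (1 + b ^ 2) ^ n ≤ Real.exp (b ^ 2) ^ n := by
            gcongr
            rw [add_comm]
            exact Real.add_one_le_exp _
        _ = Real.exp (n * b ^ 2) := (Real.exp_nat_mul _ _).symm
        _ ≤ _ := Real.exp_le_exp.2 hb2
    have hcard : Real.exp (x / (2 * R + 1)) / 2 ≤ (m : ℝ) := by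
      have h1 : (2 ^ l : ℝ) ≤ 2 * m := by
        have : 2 ^ l ≤ 2 * m := by lia
        exact_mod_cast this
      have h2 := Real.exp_le_exp.2 hΛR
      rw [hexpΛ] at h2
      linarith
    rw [Fintype.card_fin, Real.exp_sub]
    calc ((1 + b ^ 2) ^ n - 1) / m ≤ Real.exp (ε ^ 2 * Real.log n) / m := by
          gcongr
          linarith
      _ ≤ Real.exp (ε ^ 2 * Real.log n) / (Real.exp (x / (2 * R + 1)) / 2) := by gcongr
      _ = _ := by field_simp
  linarith

/-! ### Choice of constants and conclusion -/

theorem theorem3 (S : ℕ) (W : IntervalWaveletBasis S) (R B L α : ℝ)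
    (hR : 0 < R) (hRS : R < S) (hB : 1 ≤ B) (hL : 1 ≤ L) (hα : 0 < α) (hα' : α < 1 / 3) :
    ∃ ζ₀ : ℝ, 0 < ζ₀ ∧ ∀ ζ : ℝ, ζ₀ ≤ ζ → ∀ r : ℝ, 0 < r → r < R →
      ∀ G : ℕ → Finset ℝ, (∀ᶠ n in atTop, IsGrid r R ζ n (G n)) →
      ∀ s s' : ℕ → ℝ, (∀ᶠ n in atTop, s n ∈ G n ∧ s' n ∈ G n ∧ s n < s' n) →
      ∀ ρ : ℕ → ℝ → ℝ, (∀ n t, 0 ≤ ρ n t) →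
      ∀ C : ∀ n, ConfidenceBand n,
        AsymptoticallyHonest C α
          (fun n => W.densityBall B (s' n) ∪ W.separatedBall B (s n) (ρ n (s n)) (G n)) →
        (∀ᶠ n in atTop,
          (⨆ f ∈ W.densityBall B (s' n), (C n).expectedDiam f)
            ≤ ENNReal.ofReal (L * rate n (s' n))) →
        (∀ᶠ n in atTop,
          (⨆ f ∈ W.separatedBall B (s n) (ρ n (s n)) (G n), (C n).expectedDiam f)
            ≤ ENNReal.ofReal (L * rate n (s n))) →
        0 < liminf (fun n => ENNReal.ofReal (ρ n (s n) / rate n (s n))) atTop := by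
  obtain ⟨M, -, hM⟩ := W.exists_motherWavelet_le
  have hR1 : 0 < 2 * R + 1 := by positivity
  -- This makes `n^{ε²}` of smaller order than the number of bumps, at least `e^{x/(2R+1)} / 2` with
  -- `x` eventually above `(3/4) log n`.
  set ε : ℝ := √(1 / (4 * (2 * R + 1))) with hε
  have hε0 : 0 < ε := by positivity
  have hεsq : ε ^ 2 = 1 / (4 * (2 * R + 1)) := Real.sq_sqrt (by positivity)
  have hε1 : ε ≤ 1 := by
    rw [hε, Real.sqrt_le_one]
    rw [div_le_one (by positivity)]
    linarith
  set c : ℝ := ε / 2 * Real.exp (-(R * Real.log 2)) / ((∫ x, |motherWavelet W.N W.h W.φ x|) + 1)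
    with hc
  have hK0 : 0 ≤ ∫ x, |motherWavelet W.N W.h W.φ x| := integral_nonneg fun x => abs_nonneg _
  have hc0 : 0 < c := by positivity
  -- The final bound `2(α + δ) + δ + δ` equals `α + 1/2`, which is below one.
  set δ : ℝ := (1 - 2 * α) / 8 with hδ
  have hδ0 : 0 < δ := by rw [hδ]; linarith
  have hexp : ∀ q : ℝ, 0 < q → ∀ A b : ℝ, 0 < b →
      ∀ᶠ ζ : ℝ in atTop, A * Real.exp (-(ζ / q)) ≤ b := fun q hq A b hb => by
    have h1 : Tendsto (fun ζ : ℝ => A * Real.exp (-(ζ / q))) atTop (𝓝 (A * 0)) :=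
      (Real.tendsto_exp_neg_atTop_nhds_zero.comp (tendsto_id.atTop_div_const hq)).const_mul A
    rw [mul_zero] at h1
    exact h1.eventually_le_const hb
  obtain ⟨ζ₀, hζ₀⟩ := eventually_atTop.1
    (((hexp (2 * (2 * R + 1)) (by positivity) B (ε / 2) (by positivity)).and
      (hexp (2 * (2 * R + 1) ^ 2) (by positivity) L (δ * c) (by positivity))).and
      (eventually_gt_atTop 0))
  refine ⟨ζ₀, (hζ₀ ζ₀ le_rfl).2, fun ζ hζ r hr hrR G hG s s' hs ρ hρ C hhon hdiam _ => ?_⟩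
  obtain ⟨⟨hζ1, hζ2⟩, hζpos⟩ := hζ₀ ζ hζ
  by_contra hcon
  -- A single sufficiently large `n` with `ρ` below `c * rate n s` will give the contradiction.
  have hfreq : ∃ᶠ n in atTop, ENNReal.ofReal (ρ n (s n) / rate n (s n)) < ENNReal.ofReal c := by
    refine frequently_lt_of_liminf_lt (by isBoundedDefault) ?_
    exact (not_lt.1 hcon).trans_lt (ENNReal.ofReal_pos.2 hc0)
  have hcov : ∀ᶠ n in atTop, ENNReal.ofReal (1 - (α + δ)) <
      ⨅ f ∈ W.densityBall B (s' n) ∪ W.separatedBall B (s n) (ρ n (s n)) (G n),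
        sampleLaw n f ((C n).cover f) := by
    refine eventually_lt_of_lt_liminf (lt_of_lt_of_le ?_ hhon)
    exact (ENNReal.ofReal_lt_ofReal_iff (by linarith)).2 (by linarith)
  have hlog : Tendsto (fun n : ℕ => Real.log n) atTop atTop :=
    Real.tendsto_log_atTop.comp tendsto_natCast_atTop_atTop
  have hx : Tendsto (fun n : ℕ => Real.log (n / Real.log n) - 3 / 4 * Real.log n) atTop atTop := by
    -- With `y = log n` the difference is `y/4 - log y`; half of the linear term absorbs the
    -- logarithm.
    have h1 : Tendsto (fun y : ℝ => y / 8 + (y / 8 - Real.log y)) atTop atTop := by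
      have h2 : ∀ᶠ y : ℝ in atTop, 0 ≤ y / 8 - Real.log y := by
        filter_upwards [Real.isLittleO_log_id_atTop.bound (by norm_num : (0 : ℝ) < 1 / 8),
          eventually_ge_atTop 1] with y hy hy1
        rw [Real.norm_eq_abs, Real.norm_eq_abs, id, abs_of_nonneg (by linarith : (0 : ℝ) ≤ y)] at hy
        linarith [le_abs_self (Real.log y)]
      refine tendsto_atTop_add_right_of_le' _ 0 (tendsto_id.atTop_div_const (by norm_num)) h2
    refine (h1.comp hlog).congr' ?_
    filter_upwards [hlog.eventually_gt_atTop 0, eventually_gt_atTop 0] with n hn hn0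
    have : (n : ℝ) ≠ 0 := by positivity
    simp only [Function.comp_apply]
    rw [Real.log_div this hn.ne']
    ring
  have hx' : Tendsto (fun n : ℕ => Real.log (n / Real.log n)) atTop atTop := by
    refine tendsto_atTop_mono' _ ?_ hx
    filter_upwards [hlog.eventually_ge_atTop 0] with n hn
    linarith
  have hlarge : ∀ q : ℝ, 0 < q → ∀ A : ℝ,
      ∀ᶠ n : ℕ in atTop, A ≤ Real.exp (Real.log (n / Real.log n) * q) := fun q hq A =>
    (Real.tendsto_exp_atTop.comp (hx'.atTop_mul_const hq)).eventually_ge_atTop A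
  have hchi : ∀ᶠ n : ℕ in atTop,
      √(2 * Real.exp (ε ^ 2 * Real.log n - Real.log (n / Real.log n) / (2 * R + 1))) ≤ δ := by
    filter_upwards [((Real.tendsto_exp_neg_atTop_nhds_zero.comp
      (hx.atTop_div_const hR1)).const_mul 2).eventually_le_const
      (by simpa using pow_pos hδ0 2), hlog.eventually_ge_atTop 0] with n hn hlogn
    refine Real.sqrt_le_iff.2 ⟨hδ0.le, le_trans ?_ hn⟩
    simp only [Function.comp_apply]
    refine mul_le_mul_of_nonneg_left (Real.exp_le_exp.2 ?_) zero_le_two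
    rw [hεsq, sub_div, neg_sub]
    have : 1 / (4 * (2 * R + 1)) * Real.log n ≤ 3 / 4 * Real.log n / (2 * R + 1) := by
      rw [div_mul_eq_mul_div, one_mul, div_le_div_iff₀ (by positivity) hR1]
      nlinarith
    linarith
  obtain ⟨n, hρc, hGn, hsn, hcovn, hdiamn, hxn, hlogn, hn1, hlev, hposn, hchin⟩ :=
    (hfreq.and_eventually (hG.and (hs.and (hcov.and (hdiam.and ((hx.eventually_ge_atTop 0).and
      ((hlog.eventually_gt_atTop 0).and ((eventually_gt_atTop 1).and
      ((hlarge (1 / (2 * R + 1)) (by positivity) (2 ^ (W.J₀ + 1))).and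
      ((hlarge (r / (2 * R + 1)) (by positivity) M).and hchi)))))))))).exists
  have hrate : 0 < rate n (s n) := by rw [rate_eq_exp hn1]; positivity
  have hρ' : ρ n (s n) ≤ c * rate n (s n) := by
    rw [← div_le_iff₀ hrate]
    exact ((ENNReal.ofReal_lt_ofReal_iff hc0).1 hρc).le
  have hsI := hGn.subset_Icc hsn.1
  have hsI' := hGn.subset_Icc hsn.2.1
  have := one_le_of_band W (a := α + δ) (η := δ) (δ := δ) hB hM hε0 hε1 hn1 rfl
    (by linarith) hr hsI.1 hsI.2 hsI'.2 hsn.2.2 hζpos (by rwa [mul_one_div] at hlev) hposn hc hζ1 hζ2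
    hchin (by linarith) hρ' hGn hsn.1 hsn.2.1 (C n)
    (fun f hf => hcovn.le.trans (iInf₂_le f hf))
    (fun f hf => (le_iSup₂ (f := fun f _ => (C n).expectedDiam f) f hf).trans hdiamn)
  rw [hδ] at this
  linarith

end
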